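/- Let $M=(m_{st})_{s,t\in S}$ be a Coxeter matrix over a (possibly infinite) set $S$ that is right-angled, i.e. $m_{st}=m_{ts}\in\{2,\infty\}$ for $s\neq t$ and $m_{ss}=1$, and let $P=A_M^+=\langle S\mid st=ts \text{ whenever } m_{st}=2\rangle$ be the corresponding right-angled Artin monoid, with identity $e$. Write $p\le q$ if $q\in pP$. For $U\subset P$ let $\vee U\in P$ be the least common upper bound (right LCM) of $U$ for $\le$ if it exists, and $\vee U=\infty$ otherwise. An atom is a noninvertible element that is not a product of two noninvertible elements. A list is a map $\lambda:\{1,\dots,n\}\to P\cup\{\infty\}$. It is a leaf if all its terms are atoms or $\infty$, or if some term is invertible. If $\lambda$ is not a leaf, let $i$ be the smallest index for which $\lambda(i)$ is a product of two noninvertible elements of $P$, choose a factorization $\lambda(i)=pq$ with $p$ an atom and $q$ noninvertible, and define two lists: $\lambda_1$ is obtained from $\lambda$ by replacing $\lambda(i)$ by $p$; and $\lambda_2(j)=p^{-1}(p\vee\lambda(j))$, to be read as $\infty$ if $\lambda(j)=\infty$ or $p\vee\lambda(j)=\infty$. The tree of $\lambda$ is the binary tree with root $\lambda$ in which each node $\nu$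 that is not a leaf has the two children $\nu_1,\nu_2$ and leaves have no children (the atom $p$ may be chosen independently at each node). (1) For every list $\lambda$ such trees exist, and each of them is finite, whatever the choices made. (2) (Reduction of positivity to generators.) Let $A$ be a $C^*$-algebra and let $X=\{X_p\}_{p\in P}$ be a product system of $C^*$-correspondences over $P$ with $X_e=A$ (associative products $X_p\times X_q\to X_{pq}$, given by the left and right actions of $A$ when one factor is $X_e=A$, and inducing isometric isomorphisms $X_p\otimes_A X_q\cong X_{pq}$ for $p\ne e$). Let $N:P\to(0,\infty)$ be a multiplicative homomorphism, $\beta\in\mathbb R$, and $\tau$ a tracial state on $A$. For $a\in A_+$ let $$\operatorname{Tr}^p_\tau(a)=\sup_H\sum_{\xi\in H}\tau(\langle\xi,a\xi\rangle)\in[0,\infty],$$ the supremum being over finite $H\subset X_p$ with $\sum_{\xi\in H}\theta_{\xi,\xi}\le 1$, where $\theta_{\xi,\xi}\eta=\xi\langle\xi,\eta\rangle$. For $J\subset P$ finite consider the condition $$\tau(a)+\sum_{\emptyset\neq K\subset J}(-1)^{|K|}N(\vee K)^{-\beta}\operatorname{Tr}_\tau^{\vee K}(a)\ \ge 0\qquad\text{for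 all } a\in A_+,\qquad(*_J)$$ where terms with $\vee K=\infty$ are zero (and, for infinite traces, a sum with a summand $-\infty$ is $-\infty$). Then $\tau$ satisfies $(*_J)$ for every finite $J\subset P\setminus\{e\}$ if and only if $\tau$ satisfies $(*_J)$ for every finite subset $J$ of the set of canonical generators of $P$. -/

import Mathlib

open scoped ENNReal

/-! ### Artin monoids -/

/-- The alternating word `s t s ...` of length `m`, beginning with `s`. -/
def altWord {S : Type*} : ℕ → S → S → List S
  | 0, _, _ => []
  | m + 1, s, t => s :: altWord m t s

/-- The defining relations `⟨st⟩^{m_st} = ⟨ts⟩^{m_ts}` of the Artin monoid. The value `m_st = 0`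
encodes `m_st = ∞`; the relation is then `[] = []`, that is, no relation. -/
def artinRel {S : Type*} (M : CoxeterMatrix S) : FreeMonoid S → FreeMonoid S → Prop :=
  fun u v => ∃ s t : S,
    u = FreeMonoid.ofList (altWord (M s t) s t) ∧ v = FreeMonoid.ofList (altWord (M t s) t s)

/-- The Artin monoid `A_M⁺`. -/
abbrev ArtinMonoid {S : Type*} (M : CoxeterMatrix S) : Type _ :=
  PresentedMonoid (artinRel M)

/-- The set of canonical generators of the Artin monoid. -/
def artinGenerators {S : Type*} (M : CoxeterMatrix S) : Set (ArtinMonoid M) :=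
  Set.range (PresentedMonoid.of (artinRel M))

/-- Right-angled: every off-diagonal entry is `2` or `∞` (encoded by `0`). -/
def IsRightAngled {S : Type*} (M : CoxeterMatrix S) : Prop :=
  ∀ s t : S, s ≠ t → M s t = 2 ∨ M s t = 0

/-! ### Right least common multiples and the tree of a list -/

/-- `r` is a right LCM of `U`. In a monoid, `p ∣ q` means `∃ c, q = p * c`. -/
def IsRightLCM {P : Type*} [Monoid P] (U : Set P) (r : P) : Prop :=
  (∀ u ∈ U, u ∣ r) ∧ ∀ r', (∀ u ∈ U, u ∣ r') → r ∣ r'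

/-- `⋁ U ∈ P ∪ {∞}`: a right LCM of `U` if there is one, and `∞` otherwise. -/
noncomputable def rightLCM {P : Type*} [Monoid P] (U : Set P) : WithTop P := by
  classical exact if h : ∃ r, IsRightLCM U r then (h.choose : WithTop P) else ⊤

/-- A list in `P ∪ {∞}` is a leaf if all its terms are atoms or `∞`, or if some term is
invertible. -/
def IsLeaf {P : Type*} [Monoid P] {n : ℕ} (μ : Fin n → WithTop P) : Prop :=
  (∀ j, μ j = ⊤ ∨ ∃ x : P, Irreducible x ∧ μ j = x) ∨ ∃ j, ∃ x : P, IsUnit x ∧ μ j = x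

/-- `x` is an element of `P` that is a product of two noninvertible elements. -/
def IsDecomposable {P : Type*} [Monoid P] (x : WithTop P) : Prop :=
  ∃ p q : P, ¬ IsUnit p ∧ ¬ IsUnit q ∧ x = ((p * q : P) : WithTop P)

/-- `i` is the smallest index at which `μ` has a decomposable term, and `μ i = p * q` with `p` an
atom and `q` noninvertible. -/
structure IsFirstFactorization {P : Type*} [Monoid P] {n : ℕ} (μ : Fin n → WithTop P)
    (i : Fin n) (p q : P) : Prop where
  eq : μ i = ((p * q : P) : WithTop P)
  atom : Irreducible p
  not_isUnit : ¬ IsUnit q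
  first : ∀ j < i, ¬ IsDecomposable (μ j)

/-- `IsResidue p x y` : `y` is a value of `p⁻¹ (p ∨ x)`, with `y = ∞` when `p ∨ x = ∞`. -/
inductive IsResidue {P : Type*} [Monoid P] (p : P) : WithTop P → WithTop P → Prop
  | lcm (x y : P) (h : IsRightLCM {p, x} (p * y)) : IsResidue p x y
  | no_lcm (x : P) (h : ¬ ∃ r, IsRightLCM {p, x} r) : IsResidue p x ⊤
  | top : IsResidue p ⊤ ⊤

/-- A tree of the list `μ`: the root is `μ`, every node `ν` that is not a leaf has the two
children `ν₁` and `ν₂` determined by some first factorization `ν i = p * q`, and leaves have no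
children. The nodes are addressed by words in `{1, 2}`, coded by `{0, 1} = Fin 2`, with the most
recent letter first. The choices left open by the construction (the atom `p`, the least common
multiples) may be made differently at every node; only the labels at addresses in `nodes` matter. -/
structure ListTree {P : Type*} [Monoid P] {n : ℕ} (μ : Fin n → WithTop P) where
  nodes : Set (List (Fin 2))
  label : List (Fin 2) → Fin n → WithTop P
  nil_mem : [] ∈ nodes
  label_nil : label [] = μ
  cons_mem : ∀ b ω, b :: ω ∈ nodes ↔ ω ∈ nodes ∧ ¬ IsLeaf (label ω)
  label_cons : ∀ ω ∈ nodes, ¬ IsLeaf (label ω) →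
    ∃ i p q, IsFirstFactorization (label ω) i p q ∧
      label (0 :: ω) = Function.update (label ω) i (p : WithTop P) ∧
      ∀ j, IsResidue p (label ω j) (label (1 :: ω) j)

/-! ### Correspondences, product systems and induced traces -/

/-- A C⋆-correspondence over `A`: a (complete) right Hilbert `A`-module `E`, whose inner product is
linear in the second variable, with a left action of `A` by adjointable operators.
(The class `CStarModule` of Mathlib is about left modules: it has `⟪x, a • y⟫ = a * ⟪x, y⟫`.) -/
class CStarCorrespondence (A : Type*) (E : Type*) [NonUnitalCStarAlgebra A] [PartialOrder A]
    [NormedAddCommGroup E] [NormedSpace ℂ E] [CompleteSpace E] where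
  /-- the `A`-valued inner product -/
  inn : E → E → A
  /-- the right action, `ract a x = x a` -/
  ract : A →ₗ[ℂ] Module.End ℂ E
  /-- the left action, `lact a x = φ(a) x` -/
  lact : A →ₙₐ[ℂ] Module.End ℂ E
  ract_mul : ∀ a b x, ract (a * b) x = ract b (ract a x)
  inn_add_right : ∀ x y z, inn x (y + z) = inn x y + inn x z
  inn_smul_right : ∀ (c : ℂ) x y, inn x (c • y) = c • inn x y
  inn_ract_right : ∀ a x y, inn x (ract a y) = inn x y * a
  star_inn : ∀ x y, star (inn x y) = inn y x
  inn_self_nonneg : ∀ x, 0 ≤ inn x x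
  norm_sq : ∀ x, ‖x‖ ^ 2 = ‖inn x x‖
  inn_lact : ∀ a x y, inn (lact a x) y = inn x (lact (star a) y)

open CStarCorrespondence

/-- The rank-one operator `θ_{ξ,ζ} η = ξ ⟨ζ, η⟩`. -/
def rankOne (A : Type*) {E : Type*} [NonUnitalCStarAlgebra A] [PartialOrder A]
    [NormedAddCommGroup E] [NormedSpace ℂ E] [CompleteSpace E] [CStarCorrespondence A E]
    (ξ ζ η : E) : E :=
  ract (inn ζ η : A) ξ

/-- `Tr_τ^E(a) ∈ [0, ∞]` for `a ≥ 0`: the supremum of `∑_{ξ ∈ H} τ(⟨ξ, a ξ⟩)` over all finite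
`H ⊆ E` with `∑_{ξ ∈ H} θ_{ξ,ξ} ≤ 1`. The order of self-adjoint operators on a Hilbert module is
given by `S ≤ T ↔ ∀ η, ⟨η, S η⟩ ≤ ⟨η, T η⟩`. -/
noncomputable def inducedTrace {A : Type*} (E : Type*) [NonUnitalCStarAlgebra A] [PartialOrder A]
    [NormedAddCommGroup E] [NormedSpace ℂ E] [CompleteSpace E] [CStarCorrespondence A E]
    (τ : A →L[ℂ] ℂ) (a : A) : ℝ≥0∞ :=
  ⨆ (H : Finset E) (_ : ∀ η : E, (inn η (∑ ξ ∈ H, rankOne A ξ ξ η) : A) ≤ inn η η),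
    ENNReal.ofReal (∑ ξ ∈ H, (τ (inn ξ (lact a ξ))).re)

/-- A tracial state: a positive linear functional of norm one with `τ(ab) = τ(ba)`. -/
structure IsTracialState {A : Type*} [NonUnitalCStarAlgebra A] [PartialOrder A]
    (τ : A →L[ℂ] ℂ) : Prop where
  nonneg : ∀ a, 0 ≤ a → 0 ≤ (τ a).re ∧ (τ a).im = 0
  norm_eq_one : ‖τ‖ = 1
  trace : ∀ a b, τ (a * b) = τ (b * a)

/-- A product system over `P` of C⋆-correspondences `X p` over `A`. The multiplication of the
total space `Σ p, X p` is associative; `X 1` is the canonical correspondence `A` and the products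
with its elements are the left and right actions. The condition that `ξ ⊗ ζ ↦ ξ ζ` extends to an
isometric isomorphism of `X p ⊗_A X q` onto `X (p * q)`, where `X p ⊗_A X q` is the completion of
the algebraic tensor product for `⟨ξ ⊗ ζ, ξ' ⊗ ζ'⟩ = ⟨ζ, ⟨ξ, ξ'⟩ ζ'⟩`, says that the products have
these inner products and span a dense subspace. Density is imposed for `p ≠ 1` only, so
that the fibres need not be essential; the formula for the inner products is automatic for
`p = 1`. -/
structure ProductSystem (A : Type*) {P : Type*} [Monoid P] (X : P → Type*)
    [NonUnitalCStarAlgebra A] [PartialOrder A]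
    [∀ p, NormedAddCommGroup (X p)] [∀ p, NormedSpace ℂ (X p)] [∀ p, CompleteSpace (X p)]
    [∀ p, CStarCorrespondence A (X p)] where
  mul : ∀ {p q : P}, X p →ₗ[ℂ] X q →ₗ[ℂ] X (p * q)
  mul_assoc : ∀ {p q r : P} (ξ : X p) (η : X q) (ζ : X r),
    (⟨_, mul (mul ξ η) ζ⟩ : Σ p, X p) = ⟨_, mul ξ (mul η ζ)⟩
  inn_mul : ∀ {p q : P} (ξ ξ' : X p) (ζ ζ' : X q),
    (inn (mul ξ ζ) (mul ξ' ζ') : A) = inn ζ (lact (inn ξ ξ' : A) ζ')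
  dense_mul : ∀ p q : P, p ≠ 1 →
    Dense (Submodule.span ℂ {x : X (p * q) | ∃ (ξ : X p) (ζ : X q), mul ξ ζ = x} : Set (X (p * q)))
  /-- the identification of `A` with the fibre `X 1` -/
  unit : A ≃ₗ[ℂ] X 1
  inn_unit : ∀ a b : A, inn (unit a) (unit b) = star a * b
  lact_unit : ∀ a b : A, lact a (unit b) = unit (a * b)
  ract_unit : ∀ a b : A, ract a (unit b) = unit (b * a)
  unit_mul : ∀ {p : P} (a : A) (ξ : X p), (⟨_, mul (unit a) ξ⟩ : Σ p, X p) = ⟨p, lact a ξ⟩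
  mul_unit : ∀ {p : P} (a : A) (ξ : X p), (⟨_, mul ξ (unit a)⟩ : Σ p, X p) = ⟨p, ract a ξ⟩

/-! ### The positivity condition -/

/-- The summand `(-1)^{|K|} N(⋁K)^{-β} Tr_τ^{⋁K}(a)`, which is zero when `⋁K = ∞`. It is an
extended real number because an induced trace may be infinite. -/
noncomputable def positivityTerm {A P : Type*} [Monoid P] (X : P → Type*)
    [NonUnitalCStarAlgebra A] [PartialOrder A]
    [∀ p, NormedAddCommGroup (X p)] [∀ p, NormedSpace ℂ (X p)] [∀ p, CompleteSpace (X p)]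
    [∀ p, CStarCorrespondence A (X p)]
    (N : P →* ℝ) (β : ℝ) (τ : A →L[ℂ] ℂ) (a : A) (K : Finset P) : EReal :=
  match rightLCM (K : Set P) with
  | (r : P) => (((-1) ^ K.card * N r ^ (-β) : ℝ) : EReal) * (inducedTrace (X r) τ a : EReal)
  | ⊤ => 0

/-- The positivity condition for the finite subsets of `T`:
`τ(a) + ∑_{∅ ≠ K ⊆ J} (-1)^{|K|} N(⋁K)^{-β} Tr_τ^{⋁K}(a) ≥ 0` for all `a ≥ 0` in `A` and all finite
`J ⊆ T`. In `EReal` one has `∞ + (-∞) = -∞`, so the inequality fails whenever a summand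
is `-∞`. For `J = {q}` it says that `N(q)^{-β} Tr_τ^q(a) ≤ τ(a)`, so that `Tr_τ^q(a)` is finite. -/
def PositivityOn {A P : Type*} [Monoid P] (X : P → Type*)
    [NonUnitalCStarAlgebra A] [PartialOrder A]
    [∀ p, NormedAddCommGroup (X p)] [∀ p, NormedSpace ℂ (X p)] [∀ p, CompleteSpace (X p)]
    [∀ p, CStarCorrespondence A (X p)]
    (N : P →* ℝ) (β : ℝ) (τ : A →L[ℂ] ℂ) (T : Set P) : Prop :=
  ∀ J : Finset P, (J : Set P) ⊆ T → ∀ a : A, 0 ≤ a →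
    0 ≤ (((τ a).re : ℝ) : EReal) +
      ∑ K ∈ J.powerset.filter (fun K => K.Nonempty), positivityTerm X N β τ a K

/-! ### Right-angled Artin monoids -/

namespace ArtinMonoid

variable {S : Type*} {M : CoxeterMatrix S}

/-! Write `φ_a(x) = N(x)^{-β} Tr_τ^x(a)`. Since `Tr_τ^e = τ`, the condition for `J` says that the
alternating sum of `φ_a` over the intersections of the right ideals `kP`, `k ∈ J`, is nonnegative:
such an intersection is principal exactly when the right LCM exists, and otherwise counts as zero.

Suppose an entry equals `sq` with `s` a generator. By inclusion-exclusion the sum for a list is the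
sum with `sq` replaced by `s`, plus a sum carried by the ideal `sP`. Pulled back along `x ↦ sx`, the
latter is the alternating sum of `x ↦ φ_a(sx)` for the list of the `s⁻¹(s ∨ λ(j))`. Induction of
traces in stages writes `Tr^{sx}(a)` as the limit of `∑ Tr^x(⟨ξ, aξ⟩)` over an approximate unit `∑
θ_{ξ,ξ}` of `X_s`. So positivity of the second list for all `a ≥ 0` passes to the translated
functions (`altSum_weightedTrace_gen_mul_nonneg`), and `altSum_nonneg` carries out the descent.

Both this descent and the tree terminate because, in the right-angled case, `s⁻¹(s ∨ x)` is never
longer than `x` (`dvd_gen_mul_cases`), and is shorter when `x = sq`. In the descent, entries equal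
to `∞` and repetitions can be dropped, an entry `e` makes the sum vanish, and distinct generators
are covered by the hypothesis. Single generators also bound every induced trace by a multiple of `τ`
(`exists_inducedTrace_le`), so all sums are real.

Induction in stages (`tendsto_sum_inducedTrace`) combines products of Bessel families in one
direction with the trace property in the other. The operator inequalities it needs are proved by
hand, from positivity of integer polynomials in one symmetric operator. -/

/-- The canonical generator of the Artin monoid at `s`. -/
abbrev gen (M : CoxeterMatrix S) (s : S) : ArtinMonoid M := PresentedMonoid.of (artinRel M) s

theorem length_altWord (m : ℕ) (s t : S) : (altWord m s t).length = m := by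
  induction m generalizing s t with
  | zero => rfl
  | succ m ih => simp [altWord, ih]

theorem prod_map_ofAdd_one (l : List S) :
    (l.map fun _ => Multiplicative.ofAdd (1 : ℕ)).prod = Multiplicative.ofAdd l.length := by
  induction l with
  | nil => rfl
  | cons a l ih => rw [List.map_cons, List.prod_cons, ih, ← ofAdd_add, List.length_cons, add_comm]

/-- The length homomorphism. -/
def lengthHom (M : CoxeterMatrix S) : ArtinMonoid M →* Multiplicative ℕ :=
  PresentedMonoid.lift (fun _ => Multiplicative.ofAdd 1) (by
    rintro _ _ ⟨s, t, rfl, rfl⟩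
    simp only [FreeMonoid.lift_apply, FreeMonoid.toList_ofList, prod_map_ofAdd_one,
      length_altWord, M.symmetric s t])

/-- The word length of an element. -/
def len (x : ArtinMonoid M) : ℕ := Multiplicative.toAdd (lengthHom M x)

@[simp] theorem len_one : len (1 : ArtinMonoid M) = 0 := by simp [len]

@[simp] theorem len_mul (x y : ArtinMonoid M) : len (x * y) = len x + len y := by simp [len]

@[simp] theorem len_gen (s : S) : len (gen M s) = 1 := by
  simp [len, lengthHom, gen]

theorem induction_gen {motive : ArtinMonoid M → Prop} (one : motive 1)
    (gen_mul : ∀ s x, motive x → motive (gen M s * x)) (x : ArtinMonoid M) : motive x := by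
  induction x using PresentedMonoid.inductionOn with
  | _ w =>
    induction w using FreeMonoid.inductionOn' with
    | one => simpa using one
    | of_mul s w ih =>
      rw [map_mul]
      exact gen_mul s _ ih

theorem eq_one_or_eq_gen_mul (x : ArtinMonoid M) : x = 1 ∨ ∃ s y, x = gen M s * y := by
  induction x using induction_gen with
  | one => exact Or.inl rfl
  | gen_mul s x _ => exact Or.inr ⟨s, x, rfl⟩

theorem len_eq_zero {x : ArtinMonoid M} : len x = 0 ↔ x = 1 := by
  refine ⟨fun h => ?_, fun h => h ▸ len_one⟩
  obtain rfl | ⟨s, y, rfl⟩ := eq_one_or_eq_gen_mul x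
  · rfl
  · simp at h

theorem isUnit_iff_eq_one {x : ArtinMonoid M} : IsUnit x ↔ x = 1 := by
  refine ⟨fun h => ?_, fun h => h ▸ isUnit_one⟩
  obtain ⟨y, hy⟩ := h.exists_right_inv
  have := congrArg len hy
  rw [len_mul, len_one] at this
  exact len_eq_zero.1 (by omega)

theorem irreducible_gen (s : S) : Irreducible (gen M s) := by
  constructor
  · intro h
    have := congrArg len (isUnit_iff_eq_one.1 h)
    simp at this
  · intro a b h
    have := congrArg len h
    rw [len_mul, len_gen] at this
    rw [isUnit_iff_eq_one, isUnit_iff_eq_one, ← len_eq_zero, ← len_eq_zero]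
    omega

theorem gen_ne_one (s : S) : gen M s ≠ 1 := by
  rw [Ne, ← isUnit_iff_eq_one]; exact (irreducible_gen s).not_isUnit

theorem exists_gen_of_irreducible {x : ArtinMonoid M} (hx : Irreducible x) :
    ∃ s, x = gen M s := by
  obtain rfl | ⟨s, y, rfl⟩ := eq_one_or_eq_gen_mul x
  · exact absurd isUnit_one hx.not_isUnit
  · have := (hx.isUnit_or_isUnit rfl).resolve_left (irreducible_gen s).not_isUnit
    exact ⟨s, by rw [isUnit_iff_eq_one.1 this, mul_one]⟩

theorem gen_commute {s t : S} (h : M s t = 2) : gen M s * gen M t = gen M t * gen M s := by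
  have : PresentedMonoid.mk (artinRel M) (FreeMonoid.ofList (altWord (M s t) s t)) =
      PresentedMonoid.mk (artinRel M) (FreeMonoid.ofList (altWord (M t s) t s)) :=
    PresentedMonoid.mk_eq_mk_of_rel ⟨s, t, rfl, rfl⟩
  rw [M.symmetric t s, h] at this
  simpa [altWord, FreeMonoid.ofList_cons, gen, PresentedMonoid.of] using this

/-! ### Division by a generator, cancellation and common multiples. -/

section Division

open Classical in
/-- Left multiplication by a generator on pairs `(x, p⁻¹x)`. -/
noncomputable def divStep (p s : S) (z : ArtinMonoid M × Option (ArtinMonoid M)) :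
    ArtinMonoid M × Option (ArtinMonoid M) :=
  (gen M s * z.1,
    if s = p then some z.1 else if M s p = 2 then z.2.map (gen M s * ·) else none)

/-- This is what makes `p⁻¹x` well defined on the presented monoid. The first component must be
carried along because prefixing `p` itself creates the quotient `x`, whatever the previous quotient
was. -/
theorem divStep_commute (p : S) {s t : S} (h : M s t = 2)
    (z : ArtinMonoid M × Option (ArtinMonoid M)) :
    divStep p s (divStep p t z) = divStep p t (divStep p s z) := by
  have hst := gen_commute h
  have hts : M t s = 2 := by rw [M.symmetric]; exact h
  obtain ⟨x, o⟩ := z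
  have h1 : ∀ y, gen M s * (gen M t * y) = gen M t * (gen M s * y) := fun y => by
    rw [← mul_assoc, hst, mul_assoc]
  by_cases hsp : s = p
  · subst hsp
    by_cases htp : t = s
    · subst htp; rfl
    · simp [divStep, htp, hts, h1]
  · by_cases htp : t = p
    · subst htp
      simp [divStep, hsp, h, h1]
    · by_cases h3 : M s p = 2 <;> by_cases h4 : M t p = 2 <;> cases o <;>
        simp [divStep, hsp, htp, h3, h4, h1]

/-- `divStep` as an element of the monoid of self-maps. -/
noncomputable def divStepEnd (p s : S) :
    Function.End (ArtinMonoid M × Option (ArtinMonoid M)) := divStep p s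

/-- The action of the monoid on pairs `(x, p⁻¹x)`. -/
noncomputable def divHom (hM : IsRightAngled M) (p : S) :
    ArtinMonoid M →* Function.End (ArtinMonoid M × Option (ArtinMonoid M)) :=
  PresentedMonoid.lift (divStepEnd p) (by
    rintro _ _ ⟨s, t, rfl, rfl⟩
    rw [M.symmetric t s]
    by_cases hst : s = t
    · subst hst; rfl
    rcases hM s t hst with h | h
    · rw [h]
      simp only [altWord, FreeMonoid.lift_apply, FreeMonoid.toList_ofList, List.map_cons,
        List.map_nil, List.prod_cons, List.prod_nil, mul_one]
      exact funext (divStep_commute p h)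
    · rw [h]; rfl)

/-- The quotient `p⁻¹x`, when the generator `p` divides `x`. -/
noncomputable def divGen (hM : IsRightAngled M) (p : S) (x : ArtinMonoid M) :
    Option (ArtinMonoid M) := (divHom hM p x (1, none)).2

theorem divHom_gen_mul (hM : IsRightAngled M) (p s : S) (x : ArtinMonoid M) (z) :
    divHom hM p (gen M s * x) z = divStep p s (divHom hM p x z) := by
  rw [map_mul]; rfl

theorem divHom_fst (hM : IsRightAngled M) (p : S) (x : ArtinMonoid M) :
    (divHom hM p x (1, none)).1 = x := by
  induction x using induction_gen with
  | one => rw [map_one]; rfl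
  | gen_mul s x ih => rw [divHom_gen_mul]; simp [divStep, ih]

open Classical in
theorem divGen_gen_mul (hM : IsRightAngled M) (p s : S) (x : ArtinMonoid M) :
    divGen hM p (gen M s * x) = if s = p then some x
      else if M s p = 2 then (divGen hM p x).map (gen M s * ·) else none := by
  rw [divGen, divHom_gen_mul, divStep, divHom_fst]; rfl

theorem divGen_self_mul (hM : IsRightAngled M) (p : S) (x : ArtinMonoid M) :
    divGen hM p (gen M p * x) = some x := by
  rw [divGen_gen_mul, if_pos rfl]

theorem eq_of_divGen_eq_some (hM : IsRightAngled M) (p : S) {x y : ArtinMonoid M}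
    (h : divGen hM p x = some y) :
    x = gen M p * y := by
  induction x using induction_gen generalizing y with
  | one => simp [divGen] at h; cases h
  | gen_mul s x ih =>
    rw [divGen_gen_mul] at h
    split_ifs at h with h1 h2
    · subst h1; rw [Option.some.inj h]
    · obtain ⟨z, hz, rfl⟩ := Option.map_eq_some_iff.1 h
      rw [ih hz, ← mul_assoc, gen_commute h2, mul_assoc]

theorem gen_mul_left_cancel (hM : IsRightAngled M) {p : S} {x y : ArtinMonoid M}
    (h : gen M p * x = gen M p * y) : x = y := by
  have := divGen_self_mul hM p x
  rw [h, divGen_self_mul] at this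
  exact (Option.some.inj this).symm

theorem gen_mul_dvd_gen_mul (hM : IsRightAngled M) {p : S} {x y : ArtinMonoid M} :
    gen M p * x ∣ gen M p * y ↔ x ∣ y := by
  refine ⟨fun ⟨c, hc⟩ => ⟨c, ?_⟩, mul_dvd_mul_left _⟩
  rw [mul_assoc] at hc
  exact gen_mul_left_cancel hM hc

theorem dvd_antisymm' {x y : ArtinMonoid M} (h : x ∣ y) (h' : y ∣ x) :
    x = y := by
  obtain ⟨c, rfl⟩ := h
  obtain ⟨d, hd⟩ := h'
  have := congrArg len hd
  simp only [len_mul] at this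
  rw [len_eq_zero.1 (show len c = 0 by omega), mul_one]

theorem len_le_of_dvd {x y : ArtinMonoid M} (h : x ∣ y) : len x ≤ len y := by
  obtain ⟨c, rfl⟩ := h
  simp

/-- The elements `y` with `x ∣ p y`, for a generator `p`, are none, or the multiples of a single
element that is not longer than `x`. -/
theorem dvd_gen_mul_cases (hM : IsRightAngled M) (p : S) (x : ArtinMonoid M) :
    (∀ y, ¬ x ∣ gen M p * y) ∨ ∃ z, len z ≤ len x ∧ ∀ y, x ∣ gen M p * y ↔ z ∣ y := by
  induction x using induction_gen with
  | one => exact Or.inr ⟨1, le_rfl, fun y => by simp⟩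
  | gen_mul s x ih =>
    by_cases hsp : s = p
    · subst hsp
      exact Or.inr ⟨x, by simp, fun y => gen_mul_dvd_gen_mul hM⟩
    rcases hM p s (Ne.symm hsp) with h | h
    -- For commuting `s ≠ p`, dividing `py` by `s` divides `y` by `s`. This reduces the claim to
    -- `x`.
    · have key : ∀ y, gen M s * x ∣ gen M p * y ↔ ∃ y', y = gen M s * y' ∧ x ∣ gen M p * y' := by
        intro y
        constructor
        · rintro ⟨c, hc⟩
          have h1 := divGen_gen_mul hM s p y
          rw [if_neg (Ne.symm hsp), if_pos h, hc, mul_assoc, divGen_self_mul] at h1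
          obtain ⟨y', hy', h2⟩ := Option.map_eq_some_iff.1 h1.symm
          exact ⟨y', eq_of_divGen_eq_some hM s hy', c, h2⟩
        · rintro ⟨y', rfl, hy⟩
          rw [← mul_assoc, gen_commute h, mul_assoc]
          exact mul_dvd_mul_left _ hy
      rcases ih with ih | ⟨z, hz, ih⟩
      · left
        intro y hy
        obtain ⟨y', -, h'⟩ := (key y).1 hy
        exact ih y' h'
      · refine Or.inr ⟨gen M s * z, by simpa using hz, fun y => ?_⟩
        rw [key]
        constructor
        · rintro ⟨y', rfl, hy⟩
          exact mul_dvd_mul_left _ ((ih y').1 hy)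
        · rintro ⟨c, rfl⟩
          exact ⟨z * c, mul_assoc _ _ _, (ih _).2 ⟨c, rfl⟩⟩
    -- Here `m_{ps} = ∞`, so no element beginning with `p` is divisible by `s`.
    · left
      rintro y ⟨c, hc⟩
      have h1 := divGen_gen_mul hM s p y
      rw [if_neg (Ne.symm hsp), if_neg (by omega), hc, mul_assoc, divGen_self_mul] at h1
      cases h1

end Division

end ArtinMonoid

/-! ### Trees of lists -/

namespace ArtinMonoid

variable {S : Type*} {M : CoxeterMatrix S} {n : ℕ}

theorem exists_isFirstFactorization {μ : Fin n → WithTop (ArtinMonoid M)} (hμ : ¬ IsLeaf μ) :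
    ∃ i p q, IsFirstFactorization μ i p q := by
  have hex : ∃ i, IsDecomposable (μ i) := by
    simp only [IsLeaf, not_or, not_forall, not_exists, not_and] at hμ
    obtain ⟨⟨j, hj, hj'⟩, hu⟩ := hμ
    obtain ⟨x, hx⟩ := WithTop.ne_top_iff_exists.1 hj
    have h1 : ¬ IsUnit x := fun h => hu j x h hx.symm
    have h2 : ¬ Irreducible x := fun h => hj' x h hx.symm
    rw [irreducible_iff] at h2
    push Not at h2
    obtain ⟨a, b, hab, ha, hb⟩ := h2 h1
    exact ⟨j, a, b, ha, hb, by rw [← hx, hab]⟩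
  obtain ⟨i, ⟨a, b, ha, hb, hi⟩, hmin⟩ := WellFounded.has_min (wellFounded_lt (α := Fin n))
    {i | IsDecomposable (μ i)} hex
  -- Splitting off the first letter of the left factor turns it into an atom.
  obtain rfl | ⟨s, a, rfl⟩ := eq_one_or_eq_gen_mul a
  · exact absurd isUnit_one ha
  refine ⟨i, gen M s, a * b, ⟨by rw [hi, mul_assoc], irreducible_gen s, fun h => hb ?_,
    fun j hj h => hmin j h hj⟩⟩
  rw [isUnit_iff_eq_one, ← len_eq_zero] at h ⊢
  rw [len_mul] at h
  omega

theorem exists_isResidue {P : Type*} [Monoid P] (p : P) (x : WithTop P) :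
    ∃ y, IsResidue p x y := by
  induction x using WithTop.recTopCoe with
  | top => exact ⟨⊤, .top⟩
  | coe x =>
    by_cases h : ∃ r, IsRightLCM {p, x} r
    · obtain ⟨r, hr⟩ := h
      obtain ⟨y, rfl⟩ := hr.1 p (by simp)
      exact ⟨y, .lcm x y hr⟩
    · exact ⟨⊤, .no_lcm x h⟩

/-- The word length, with `∞` counted as empty. -/
def topLen : WithTop (ArtinMonoid M) → ℕ := WithTop.recTopCoe 0 len

@[simp] theorem topLen_coe (x : ArtinMonoid M) : topLen (x : WithTop (ArtinMonoid M)) = len x := rfl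

@[simp] theorem topLen_top : topLen (⊤ : WithTop (ArtinMonoid M)) = 0 := rfl

theorem topLen_le_of_isResidue (hM : IsRightAngled M) {p : ArtinMonoid M} (hp : Irreducible p)
    {x y : WithTop (ArtinMonoid M)} (h : IsResidue p x y) : topLen y ≤ topLen x := by
  obtain ⟨s, rfl⟩ := exists_gen_of_irreducible hp
  cases h with
  | lcm x y h =>
    rcases dvd_gen_mul_cases hM s x with h' | ⟨z, hz, h'⟩
    · exact absurd (h.1 x (by simp)) (h' y)
    · refine (len_le_of_dvd ?_).trans hz
      refine (gen_mul_dvd_gen_mul hM).1 (h.2 _ ?_)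
      rintro u (rfl | rfl)
      · exact dvd_mul_right _ _
      · exact (h' z).2 dvd_rfl
  | no_lcm => simp
  | top => simp

/-- `pq` is itself a common multiple of `p` and `pq`, so the residue divides `q`. -/
theorem topLen_lt_of_isResidue (hM : IsRightAngled M) {p q : ArtinMonoid M} (hp : Irreducible p)
    {y : WithTop (ArtinMonoid M)} (h : IsResidue p ((p * q : ArtinMonoid M) : WithTop _) y) :
    topLen y < len (p * q) := by
  obtain ⟨s, rfl⟩ := exists_gen_of_irreducible hp
  cases h with
  | lcm _ y h =>
    have : len y ≤ len q := by
      refine len_le_of_dvd ((gen_mul_dvd_gen_mul hM).1 (h.2 (gen M s * q) ?_))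
      rintro u (rfl | rfl)
      · exact dvd_mul_right _ _
      · exact dvd_rfl
    simp; omega
  | no_lcm _ h => simp

/-- The total word length of a list. -/
def totalLen (μ : Fin n → WithTop (ArtinMonoid M)) : ℕ := ∑ j, topLen (μ j)

theorem totalLen_update_lt {μ : Fin n → WithTop (ArtinMonoid M)} {i : Fin n}
    {p q : ArtinMonoid M} (h : IsFirstFactorization μ i p q) :
    totalLen (Function.update μ i (p : WithTop (ArtinMonoid M))) < totalLen μ := by
  have hq : len q ≠ 0 := fun h0 => h.not_isUnit (isUnit_iff_eq_one.2 (len_eq_zero.1 h0))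
  refine Finset.sum_lt_sum (fun j _ => ?_) ⟨i, Finset.mem_univ i, ?_⟩
  · rcases eq_or_ne j i with rfl | hj
    · simp [h.eq]
    · rw [Function.update_of_ne hj]
  · rw [Function.update_self, h.eq, topLen_coe, topLen_coe, len_mul]
    omega

theorem totalLen_residue_lt (hM : IsRightAngled M) {μ ν : Fin n → WithTop (ArtinMonoid M)}
    {i : Fin n} {p q : ArtinMonoid M} (h : IsFirstFactorization μ i p q)
    (hν : ∀ j, IsResidue p (μ j) (ν j)) : totalLen ν < totalLen μ := by
  refine Finset.sum_lt_sum (fun j _ => topLen_le_of_isResidue hM h.atom (hν j))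
    ⟨i, Finset.mem_univ i, ?_⟩
  have := hν i
  rw [h.eq] at this ⊢
  exact topLen_lt_of_isResidue hM h.atom this

theorem exists_children (μ : Fin n → WithTop (ArtinMonoid M)) :
    ∃ c : Fin 2 → Fin n → WithTop (ArtinMonoid M), ¬ IsLeaf μ →
      ∃ i p q, IsFirstFactorization μ i p q ∧
        c 0 = Function.update μ i (p : WithTop (ArtinMonoid M)) ∧
        ∀ j, IsResidue p (μ j) (c 1 j) := by
  by_cases hμ : IsLeaf μ
  · exact ⟨fun _ => μ, fun h => absurd hμ h⟩
  obtain ⟨i, p, q, h⟩ := exists_isFirstFactorization hμ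
  choose ν hν using fun j => exists_isResidue p (μ j)
  exact ⟨![Function.update μ i (p : WithTop (ArtinMonoid M)), ν],
    fun _ => ⟨i, p, q, h, rfl, hν⟩⟩

theorem nonempty_listTree (μ : Fin n → WithTop (ArtinMonoid M)) : Nonempty (ListTree μ) := by
  choose c hc using exists_children (M := M) (n := n)
  let label : List (Fin 2) → Fin n → WithTop (ArtinMonoid M) :=
    List.rec μ fun b _ ν => c ν b
  -- Labels are defined at all words; a word is a node when no proper suffix of it, that is, no
  -- ancestor, carries a leaf.
  let isNode : List (Fin 2) → Prop :=
    List.rec True fun _ ω N => N ∧ ¬ IsLeaf (label ω)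
  exact ⟨{
    nodes := {ω | isNode ω}
    label := label
    nil_mem := trivial
    label_nil := rfl
    cons_mem := fun b ω => Iff.rfl
    label_cons := fun ω _ h => hc (label ω) h }⟩

/-- Each edge lowers the total length by at least one, so the depth is bounded in terms of the root
alone, independently of all choices. -/
theorem ListTree.length_add_totalLen_le (hM : IsRightAngled M)
    {μ : Fin n → WithTop (ArtinMonoid M)} (𝒯 : ListTree μ) {ω : List (Fin 2)} (hω : ω ∈ 𝒯.nodes) :
    ω.length + totalLen (𝒯.label ω) ≤ totalLen μ := by
  induction ω with
  | nil => simp [𝒯.label_nil]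
  | cons b ω ih =>
    obtain ⟨hω', hl⟩ := (𝒯.cons_mem b ω).1 hω
    obtain ⟨i, p, q, h, h0, h1⟩ := 𝒯.label_cons ω hω' hl
    have hlt : totalLen (𝒯.label (b :: ω)) < totalLen (𝒯.label ω) := by
      fin_cases b
      · exact (congrArg totalLen h0).trans_lt (totalLen_update_lt h)
      · exact totalLen_residue_lt hM h h1
    have := ih hω'
    rw [List.length_cons]
    omega

theorem ListTree.finite_nodes (hM : IsRightAngled M)
    {μ : Fin n → WithTop (ArtinMonoid M)} (𝒯 : ListTree μ) : 𝒯.nodes.Finite :=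
  (List.finite_length_le (Fin 2) (totalLen μ)).subset fun _ hω =>
    (Nat.le_add_right _ _).trans (ListTree.length_add_totalLen_le hM 𝒯 hω)

end ArtinMonoid

/-! ### Hilbert modules -/

namespace CStarCorrespondence

open Filter Topology Polynomial

variable {A E F : Type*} [NonUnitalCStarAlgebra A] [PartialOrder A] [StarOrderedRing A]
  [NormedAddCommGroup E] [NormedSpace ℂ E] [CompleteSpace E] [CStarCorrespondence A E]
  [NormedAddCommGroup F] [NormedSpace ℂ F] [CompleteSpace F] [CStarCorrespondence A F]

section Inner

omit [StarOrderedRing A]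

theorem inn_add_left (x y z : E) : (inn (x + y) z : A) = inn x z + inn y z := by
  rw [← star_inn, inn_add_right, star_add, star_inn, star_inn]

theorem inn_smul_left (c : ℂ) (x y : E) : (inn (c • x) y : A) = star c • inn x y := by
  rw [← star_inn, inn_smul_right, star_smul, star_inn]

variable (A) in
/-- The inner product as an additive map in its second variable. -/
def innRight (x : E) : E →ₗ[ℂ] A where
  toFun := inn x
  map_add' := inn_add_right x
  map_smul' c y := inn_smul_right c x y

variable (A) in
/-- The inner product as an additive map in its first variable. -/
def innLeft (y : E) : E →+ A where
  toFun x := inn x y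
  map_zero' := by
    have := inn_smul_left (A := A) 0 (0 : E) y
    simpa using this
  map_add' x x' := inn_add_left x x' y

@[simp] theorem inn_zero_right (x : E) : (inn x (0 : E) : A) = 0 := map_zero (innRight A x)
@[simp] theorem inn_zero_left (y : E) : (inn (0 : E) y : A) = 0 := map_zero (innLeft A y)
theorem inn_sub_right (x y z : E) : (inn x (y - z) : A) = inn x y - inn x z :=
  map_sub (innRight A x) y z
theorem inn_sub_left (x y z : E) : (inn (x - y) z : A) = inn x z - inn y z :=
  map_sub (innLeft A z) x y
theorem inn_sum_right {ι : Type*} (s : Finset ι) (f : ι → E) (x : E) :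
    (inn x (∑ i ∈ s, f i) : A) = ∑ i ∈ s, inn x (f i) := map_sum (innRight A x) f s

theorem inn_real_smul_right (c : ℝ) (x y : E) : (inn x (c • y) : A) = c • inn x y :=
  inn_smul_right (c : ℂ) x y
theorem inn_real_smul_left (c : ℝ) (x y : E) : (inn (c • x) y : A) = c • inn x y := by
  have := inn_smul_left (A := A) (c : ℂ) x y
  simpa using this

theorem inn_ract_left (a : A) (x y : E) : (inn (ract a x) y : A) = star a * inn x y := by
  rw [← star_inn, inn_ract_right, star_mul, star_inn]

theorem inn_lact_right (a : A) (x y : E) : (inn x (lact a y) : A) = inn (lact (star a) x) y := by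
  rw [inn_lact, star_star]

theorem eq_zero_of_inn_self {x : E} (h : (inn x x : A) = 0) : x = 0 := by
  have := norm_sq (A := A) x
  rw [h, norm_zero] at this
  simpa using this

variable (A) in
theorem eq_of_forall_inn {x y : E} (h : ∀ z, (inn z x : A) = inn z y) : x = y := by
  rw [← sub_eq_zero]
  apply eq_zero_of_inn_self (A := A)
  rw [inn_sub_right, h, sub_self]

theorem lact_mul (a b : A) (x : E) : lact (a * b) x = lact a (lact b x) := by
  rw [map_mul]; rfl

end Inner

/-! ### Cauchy-Schwarz, continuity, and contractivity of the left action. -/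

/-- The Cauchy-Schwarz inequality. -/
theorem inn_mul_inn_le (x y : E) : (inn y x * inn x y : A) ≤ ‖x‖ ^ 2 • inn y y := by
  rcases eq_or_ne x 0 with rfl | h
  · simp
  have h₁ : ∀ a : A, 0 ≤ ‖x‖ ^ 2 • (star a * a) - ‖x‖ ^ 2 • (star a * inn x y)
      - ‖x‖ ^ 2 • (inn y x * a) + ‖x‖ ^ 2 • (‖x‖ ^ 2 • (inn y y : A)) := fun a => by
    calc (0 : A) ≤ inn (ract a x - ‖x‖ ^ 2 • y) (ract a x - ‖x‖ ^ 2 • y) := inn_self_nonneg _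
      _ = star a * inn x x * a - ‖x‖ ^ 2 • (star a * inn x y)
          - ‖x‖ ^ 2 • (inn y x * a) + ‖x‖ ^ 2 • (‖x‖ ^ 2 • (inn y y : A)) := by
        simp only [inn_sub_right, inn_sub_left, inn_ract_right, inn_ract_left,
          inn_real_smul_left, inn_real_smul_right, sub_mul, mul_assoc, smul_mul_assoc,
          smul_sub]
        abel
      _ ≤ _ := by
        gcongr
        rw [norm_sq (A := A) x]
        exact CStarAlgebra.star_left_conjugate_le_norm_smul (IsSelfAdjoint.of_nonneg
          (inn_self_nonneg x))
  -- This choice of `a` cancels two of the terms in the expanded square.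
  specialize h₁ (inn x y)
  simp only [star_inn, sub_self, zero_sub, le_neg_add_iff_add_le, add_zero] at h₁
  rwa [smul_le_smul_iff_of_pos_left (pow_pos (norm_pos_iff.2 h) _)] at h₁

variable (A) in
theorem norm_inn_le (x y : E) : ‖(inn x y : A)‖ ≤ ‖x‖ * ‖y‖ := by
  have h : ‖(inn x y : A)‖ ^ 2 ≤ (‖x‖ * ‖y‖) ^ 2 := by
    calc ‖(inn x y : A)‖ ^ 2 = ‖(inn y x * inn x y : A)‖ := by
          rw [← star_inn x y, CStarRing.norm_star_mul_self, pow_two]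
      _ ≤ ‖‖x‖ ^ 2 • (inn y y : A)‖ := by
          refine CStarAlgebra.norm_le_norm_of_nonneg_of_le ?_ (inn_mul_inn_le x y)
          rw [← star_inn x y]
          exact star_mul_self_nonneg _
      _ = (‖x‖ * ‖y‖) ^ 2 := by rw [norm_smul, ← norm_sq, mul_pow]; simp
  exact (pow_le_pow_iff_left₀ (norm_nonneg _) (by positivity) two_ne_zero).1 h

variable (A) in
/-- The inner product as a continuous linear map in its second variable. -/
noncomputable def innRightL (x : E) : E →L[ℂ] A :=
  (innRight A x).mkContinuous ‖x‖ (norm_inn_le A x)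

variable (A) in
theorem continuous_inn_right (x : E) : Continuous fun y => (inn x y : A) :=
  (innRightL A x).continuous

variable (A) in
theorem continuous_inn {f g : E → E} (hf : Continuous f) (hg : Continuous g) :
    Continuous fun x => (inn (f x) (g x) : A) := by
  rw [continuous_iff_continuousAt]
  intro x
  rw [ContinuousAt, tendsto_iff_norm_sub_tendsto_zero]
  have h1 : Tendsto (fun y => ‖f y - f x‖ * ‖g y‖ + ‖f x‖ * ‖g y - g x‖) (𝓝 x) (𝓝 0) := by
    have : Continuous fun y => ‖f y - f x‖ * ‖g y‖ + ‖f x‖ * ‖g y - g x‖ := by fun_prop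
    simpa using this.tendsto x
  refine squeeze_zero (fun _ => norm_nonneg _) (fun y => ?_) h1
  have : (inn (f y) (g y) - inn (f x) (g x) : A)
      = inn (f y - f x) (g y) + inn (f x) (g y - g x) := by
    rw [inn_sub_left, inn_sub_right]; abel
  rw [this]
  exact (norm_add_le _ _).trans (add_le_add (norm_inn_le A _ _) (norm_inn_le A _ _))

variable (A) in
theorem norm_le_of_inn_le {x : E} {y : F} (h : (inn x x : A) ≤ inn y y) : ‖x‖ ≤ ‖y‖ := by
  rw [← pow_le_pow_iff_left₀ (norm_nonneg _) (norm_nonneg _) two_ne_zero, norm_sq (A := A) x,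
    norm_sq (A := A) y]
  exact CStarAlgebra.norm_le_norm_of_nonneg_of_le (inn_self_nonneg x) h

/-- `g = 1 - √(1 - h)` vanishes at `h = 0`, so the nonunital functional calculus provides it.
Formally `(1 - g)² = 1 - h`; this exhibits `⟨x, x⟩ - ⟨x, hx⟩` as `⟨x - gx, x - gx⟩ ≥ 0` without
adjoining a unit. -/
theorem exists_two_smul_sub_mul_self {h : A} (h0 : 0 ≤ h) (h1 : ‖h‖ ≤ 1) :
    ∃ g : A, IsSelfAdjoint g ∧ g + g - g * g = h := by
  have hsa : IsSelfAdjoint h := .of_nonneg h0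
  have hc : Continuous fun t : ℝ => 1 - √(1 - t) := by fun_prop
  refine ⟨cfcₙ (fun t : ℝ => 1 - √(1 - t)) h, cfcₙ_predicate _ _, ?_⟩
  have hf0 : (fun t : ℝ => 1 - √(1 - t)) 0 = 0 := by simp
  rw [← cfcₙ_add (fun t : ℝ => 1 - √(1 - t)) (fun t : ℝ => 1 - √(1 - t)) h hc.continuousOn hf0
      hc.continuousOn hf0, ← cfcₙ_mul (fun t : ℝ => 1 - √(1 - t)) (fun t : ℝ => 1 - √(1 - t)) h
      hc.continuousOn hf0 hc.continuousOn hf0, ← cfcₙ_sub _ _ h (by fun_prop) (by simp)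
      (by fun_prop) (by simp)]
  conv_rhs => rw [← cfcₙ_id' ℝ h hsa]
  refine cfcₙ_congr fun t ht => ?_
  have ht1 : t ≤ 1 := by
    have := NonUnitalIsometricContinuousFunctionalCalculus.norm_quasispectrum_le h ht hsa
    exact (le_abs_self t).trans (this.trans h1)
  have := Real.mul_self_sqrt (sub_nonneg.2 ht1)
  nlinarith

theorem norm_lact_le_of_norm_le_one {a : A} (ha : ‖a‖ ≤ 1) (x : E) : ‖lact a x‖ ≤ ‖x‖ := by
  have h1 : ‖star a * a‖ ≤ 1 := by
    rw [CStarRing.norm_star_mul_self]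
    exact mul_le_one₀ ha (norm_nonneg _) ha
  obtain ⟨g, hg, hg'⟩ := exists_two_smul_sub_mul_self (star_mul_self_nonneg a) h1
  refine norm_le_of_inn_le A (sub_nonneg.1 ?_)
  calc (0 : A) ≤ inn (x - lact g x) (x - lact g x) := inn_self_nonneg _
    _ = inn x x - inn x (lact (g + g - g * g) x) := by
      rw [map_sub, map_add, LinearMap.sub_apply, LinearMap.add_apply, lact_mul]
      simp only [inn_sub_left, inn_sub_right, inn_add_right, inn_lact, hg.star_eq]
      abel
    _ = _ := by rw [hg', lact_mul, inn_lact_right, star_star]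

theorem norm_lact_le (a : A) (x : E) : ‖lact a x‖ ≤ ‖a‖ * ‖x‖ := by
  rcases eq_or_ne a 0 with rfl | ha
  · simp
  have hn : ‖a‖ ≠ 0 := norm_ne_zero_iff.2 ha
  have := norm_lact_le_of_norm_le_one (a := ((‖a‖⁻¹ : ℝ) : ℂ) • a)
    (by rw [norm_smul]; simp [hn]) x
  rw [map_smul, LinearMap.smul_apply, norm_smul] at this
  simp only [Complex.norm_real, norm_inv, norm_norm] at this
  rwa [inv_mul_le_iff₀ (by positivity)] at this

/-! ### Symmetric operators -/

variable (A) in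
/-- `K` is symmetric for the `A`-valued inner product. -/
def IsSymm (K : Module.End ℂ E) : Prop := ∀ x y, (inn (K x) y : A) = inn x (K y)

variable (A) in
/-- The operator `f(K)` is positive. -/
def PolyNonneg (K : Module.End ℂ E) (f : ℤ[X]) : Prop :=
  ∀ η, 0 ≤ (inn η (aeval K f η) : A)

section Symm

variable {K : Module.End ℂ E} (hK : IsSymm A K)
include hK

omit [StarOrderedRing A] in
theorem IsSymm.aeval (f : ℤ[X]) : IsSymm A (aeval K f) := by
  induction f using Polynomial.induction_on with
  | C n =>
    intro x y
    rw [aeval_C, Module.algebraMap_end_apply, Module.algebraMap_end_apply]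
    rw [← Int.cast_smul_eq_zsmul ℂ, ← Int.cast_smul_eq_zsmul ℂ, inn_smul_left, inn_smul_right]
    simp
  | add f g hf hg =>
    intro x y
    rw [map_add, LinearMap.add_apply, LinearMap.add_apply, inn_add_left, inn_add_right, hf, hg]
  | monomial n k h =>
    intro x y
    have hc := congrArg (Polynomial.aeval K) (mul_comm (C k * X ^ n) X)
    rw [map_mul, map_mul _ X, aeval_X] at hc
    rw [pow_succ, ← mul_assoc, map_mul, aeval_X, Module.End.mul_apply, h, hK,
      ← Module.End.mul_apply, ← hc]

omit [StarOrderedRing A] in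
theorem inn_aeval_mul_sq (f g : ℤ[X]) (x y : E) :
    (inn x (aeval K (g * f ^ 2) y) : A) = inn (aeval K f x) (aeval K g (aeval K f y)) := by
  rw [hK.aeval f, ← Module.End.mul_apply, ← Module.End.mul_apply, ← map_mul, ← map_mul]
  congr 3
  ring

omit [StarOrderedRing A] in
theorem PolyNonneg.mul_sq {g : ℤ[X]} (hg : PolyNonneg A K g) (f : ℤ[X]) :
    PolyNonneg A K (g * f ^ 2) := fun η => by
  rw [inn_aeval_mul_sq hK]
  exact hg _

omit [StarOrderedRing A] in
theorem polyNonneg_sq (f : ℤ[X]) : PolyNonneg A K (f ^ 2) := fun η => by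
  have := inn_aeval_mul_sq hK f 1 η η
  rw [one_mul] at this
  rw [this]
  simpa using inn_self_nonneg (A := A) (aeval K f η)

omit hK in
theorem PolyNonneg.add {f g : ℤ[X]} (hf : PolyNonneg A K f) (hg : PolyNonneg A K g) :
    PolyNonneg A K (f + g) := fun η => by
  rw [map_add, LinearMap.add_apply, inn_add_right]
  exact add_nonneg (hf η) (hg η)

/-- `f - f² = (1 - f) f² + f (1 - f)²`, which avoids square roots of operators. -/
theorem PolyNonneg.sub_sq {f : ℤ[X]} (hf : PolyNonneg A K f) (hf' : PolyNonneg A K (1 - f)) :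
    PolyNonneg A K (f - f ^ 2) := by
  have := (hf'.mul_sq hK f).add (hf.mul_sq hK (1 - f))
  convert this using 1
  ring

theorem norm_apply_le_of_polyNonneg (h0 : PolyNonneg A K X) (h1 : PolyNonneg A K (1 - X)) (x : E) :
    ‖K x‖ ≤ ‖x‖ := by
  refine norm_le_of_inn_le A (sub_nonneg.1 ?_)
  have h := ((PolyNonneg.sub_sq hK h0 h1).add h1) x
  have e : (X - X ^ 2 + (1 - X) : ℤ[X]) = 1 - X ^ 2 := by ring
  rw [e, map_sub, LinearMap.sub_apply, inn_sub_right, map_one, Module.End.one_apply, map_pow,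
    aeval_X, pow_two, Module.End.mul_apply, ← hK] at h
  exact h

/-- A symmetric operator whose powers are bounded at `y` satisfies `⟨y, K y⟩ ≤ ⟨y, y⟩`. -/
theorem inn_apply_le_of_pow_bounded {y : E} {C : ℝ} (hC : ∀ m : ℕ, ‖(K ^ m) y‖ ≤ C) :
    (inn y (K y) : A) ≤ inn y y := by
  -- From `(1 - K^n)² ≥ 0` one gets `K^n - 1 ≤ (K^{2n} - 1)/2`. Iterating along powers of two gains
  -- a factor `2^{-k}`, while boundedness keeps the right-hand bracket under control.
  have h1 : ∀ k : ℕ, (inn y (K y) : A) - inn y y ≤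
      ((2 : ℝ) ^ k)⁻¹ • (inn y ((K ^ 2 ^ k) y) - inn y y) := by
    intro k
    induction k with
    | zero => simp
    | succ k ih =>
      refine ih.trans ?_
      rw [pow_succ, mul_inv, mul_smul]
      refine smul_le_smul_of_nonneg_left ?_ (by positivity)
      have h := polyNonneg_sq hK (1 - X ^ 2 ^ k) y
      have e : (1 - X ^ 2 ^ k : ℤ[X]) ^ 2 = 1 - X ^ 2 ^ k - X ^ 2 ^ k + X ^ 2 ^ (k + 1) := by
        rw [pow_succ 2 k, pow_mul]; ring
      rw [e, map_add, map_sub, map_sub, map_one, map_pow, map_pow, aeval_X, LinearMap.add_apply,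
        LinearMap.sub_apply, LinearMap.sub_apply, Module.End.one_apply, inn_add_right,
        inn_sub_right, inn_sub_right] at h
      rw [← sub_nonneg]
      have h2 := smul_nonneg (show (0 : ℝ) ≤ 2⁻¹ by norm_num) h
      convert h2 using 1
      module
  have h2 : Tendsto (fun k : ℕ => ((2 : ℝ) ^ k)⁻¹ • ((inn y ((K ^ 2 ^ k) y) : A) - inn y y))
      atTop (𝓝 0) := by
    refine squeeze_zero_norm (a := fun k : ℕ => ((2 : ℝ)⁻¹ ^ k) * (‖y‖ * C + ‖(inn y y : A)‖))
      (fun k => ?_) ?_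
    · rw [norm_smul, inv_pow]
      have : ‖(inn y ((K ^ 2 ^ k) y) : A) - inn y y‖ ≤ ‖y‖ * C + ‖(inn y y : A)‖ :=
        (norm_sub_le _ _).trans (add_le_add ((norm_inn_le A _ _).trans
          (mul_le_mul_of_nonneg_left (hC _) (norm_nonneg _))) le_rfl)
      simpa using this
    · simpa using (tendsto_pow_atTop_nhds_zero_of_lt_one (r := (2 : ℝ)⁻¹) (by norm_num)
        (by norm_num)).mul_const (‖y‖ * C + ‖(inn y y : A)‖)
  exact sub_nonpos.1 (ge_of_tendsto' h2 h1)

end Symm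

end CStarCorrespondence

namespace CStarCorrespondence

open Filter Topology Polynomial

variable {A E F : Type*} [NonUnitalCStarAlgebra A] [PartialOrder A] [StarOrderedRing A]
  [NormedAddCommGroup E] [NormedSpace ℂ E] [CompleteSpace E] [CStarCorrespondence A E]
  [NormedAddCommGroup F] [NormedSpace ℂ F] [CompleteSpace F] [CStarCorrespondence A F]

/-! ### Bessel families and approximate units -/

variable (A) in
/-- The operator `∑ θ_{ξ,ξ}` of a finite family of vectors `ξ`. -/
def frameOp {ι : Type*} (s : Finset ι) (f : ι → E) : Module.End ℂ E where
  toFun η := ∑ i ∈ s, rankOne A (f i) (f i) η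
  map_add' x y := by
    simp only [rankOne, inn_add_right, map_add, LinearMap.add_apply, Finset.sum_add_distrib]
  map_smul' c x := by
    simp only [rankOne, inn_smul_right, map_smul, LinearMap.smul_apply, Finset.smul_sum,
      RingHom.id_apply]

variable (A) in
/-- A finite family with `∑ θ_{ξ,ξ} ≤ 1`. -/
def IsBessel {ι : Type*} (s : Finset ι) (f : ι → E) : Prop :=
  ∀ η : E, (inn η (∑ i ∈ s, rankOne A (f i) (f i) η) : A) ≤ inn η η

section

omit [StarOrderedRing A]
variable {ι : Type*} (s : Finset ι) (f : ι → E)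

theorem inn_frameOp (x y : E) :
    (inn x (frameOp A s f y) : A) = ∑ i ∈ s, inn x (f i) * inn (f i) y := by
  simp only [frameOp, LinearMap.coe_mk, AddHom.coe_mk, inn_sum_right, rankOne, inn_ract_right]

theorem isSymm_frameOp : IsSymm A (frameOp A s f) := by
  intro x y
  rw [← star_inn, inn_frameOp, inn_frameOp, star_sum]
  simp only [star_mul, star_inn]

variable {s f} in
theorem isBessel_iff :
    IsBessel A s f ↔ ∀ η : E, ∑ i ∈ s, (inn η (f i) * inn (f i) η : A) ≤ inn η η :=
  forall_congr' fun η => by rw [← inn_frameOp]; rfl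

end

section

variable {ι : Type*} (s : Finset ι) (f : ι → E)

theorem inn_mul_inn_nonneg (x y : E) : 0 ≤ (inn x y * inn y x : A) := by
  rw [← star_inn y x]
  exact star_mul_self_nonneg _

theorem polyNonneg_frameOp : PolyNonneg A (frameOp A s f) X := fun η => by
  rw [aeval_X, inn_frameOp]
  exact Finset.sum_nonneg fun i _ => inn_mul_inn_nonneg _ _

variable {s f} in
omit [StarOrderedRing A] in
theorem IsBessel.polyNonneg [IsOrderedAddMonoid A] (h : IsBessel A s f) :
    PolyNonneg A (frameOp A s f) (1 - X) := fun η => by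
  rw [map_sub, map_one, aeval_X, LinearMap.sub_apply, inn_sub_right, sub_nonneg]
  exact h η

variable {s f} in
theorem IsBessel.norm_frameOp_le (h : IsBessel A s f) (x : E) : ‖frameOp A s f x‖ ≤ ‖x‖ :=
  norm_apply_le_of_polyNonneg (isSymm_frameOp s f) (polyNonneg_frameOp s f) h.polyNonneg x

end

/-- A finite family can be replaced by a finite set of vectors without changing the sum of a
quadratic expression: repeated vectors are merged. -/
theorem exists_finset_sum_eq {E V ι : Type*} [AddCommGroup E] [Module ℂ E] [AddCommMonoid V]
    (c : ℂ) (q : E → V) (hq : ∀ v, q (c • v) = q v + q v) (s : Finset ι) (f : ι → E) :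
    ∃ H : Finset E, ∑ ξ ∈ H, q ξ = ∑ i ∈ s, q (f i) := by
  classical
  induction hn : s.card generalizing s f with
  | zero => exact ⟨∅, by rw [Finset.card_eq_zero.1 hn]; simp⟩
  | succ n ih =>
    by_cases hinj : Set.InjOn f s
    · exact ⟨s.image f, Finset.sum_image hinj⟩
    · simp only [Set.InjOn, not_forall] at hinj
      obtain ⟨i, hi, j, hj, hij, hne⟩ := hinj
      -- Drop `j` and rescale the vector at `i` by `c`, so that it counts twice. New coincidences
      -- may appear, but the family is smaller.
      have hi' : i ∈ s.erase j := Finset.mem_erase.2 ⟨hne, hi⟩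
      obtain ⟨H, hH⟩ := ih (s.erase j) (Function.update f i (c • f i))
        (by rw [Finset.card_erase_of_mem hj, hn]; rfl)
      refine ⟨H, hH.trans ?_⟩
      rw [← Finset.add_sum_erase s _ hj, ← Finset.add_sum_erase _ _ hi',
        ← Finset.add_sum_erase _ _ hi', Function.update_self, hq, ← hij, add_assoc]
      congr 2
      refine Finset.sum_congr rfl fun k hk => ?_
      rw [Function.update_of_ne (Finset.ne_of_mem_erase hk)]

-- `inducedTrace` ranges over sets of vectors, while constructions yield families with repetitions.
-- Both `θ_{ξ,ξ}` and `⟨ξ, aξ⟩` double when `ξ` is scaled by `√2`, so a single merging serves both.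
omit [StarOrderedRing A] in
theorem exists_finset_frameOp_eq (φ : A →L[ℂ] ℂ) (a : A) {ι : Type*} (s : Finset ι) (f : ι → E) :
    ∃ H : Finset E, frameOp A H (fun ξ => ξ) = frameOp A s f ∧
      ∑ ξ ∈ H, (φ (inn ξ (lact a ξ))).re = ∑ i ∈ s, (φ (inn (f i) (lact a (f i)))).re := by
  have h2 : (((√2 : ℝ) : ℂ)) * ((√2 : ℝ) : ℂ) = 2 := by
    rw [← Complex.ofReal_mul, Real.mul_self_sqrt (by norm_num)]; simp
  obtain ⟨H, hH⟩ := exists_finset_sum_eq ((√2 : ℝ) : ℂ)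
    (fun ξ : E => ((fun η => rankOne A ξ ξ η : E → E), (φ (inn ξ (lact a ξ))).re)) (by
      intro v
      refine Prod.ext (funext fun η => ?_) ?_
      · simp only [rankOne, inn_smul_left, map_smul, LinearMap.smul_apply, Prod.mk_add_mk,
          Pi.add_apply, smul_smul]
        simp [h2, two_smul]
      · simp only [inn_smul_left, inn_smul_right, map_smul, Prod.mk_add_mk, smul_smul]
        simp [h2, two_mul]) s f
  have h1 := congrArg Prod.fst hH
  have h2 := congrArg Prod.snd hH
  rw [Prod.fst_sum, Prod.fst_sum] at h1
  rw [Prod.snd_sum, Prod.snd_sum] at h2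
  refine ⟨H, LinearMap.ext fun η => ?_, h2⟩
  have := congrFun h1 η
  rwa [Finset.sum_apply, Finset.sum_apply] at this

/-! ### Approximate units from a polynomial iteration. -/

/-- The polynomials `r₀ = 1`, `r_{n+1} = r_n - X r_n²`. -/
noncomputable def residualPoly : ℕ → ℤ[X]
  | 0 => 1
  | n + 1 => residualPoly n - X * residualPoly n ^ 2

/-- If `K = ∑ θ_{g,g}`, then `K r_j(K)² = ∑ θ_{r_j(K)g, r_j(K)g}`. The telescoped sum thus shows
that `1 - r_n(K)` is again a finite sum of rank-one operators, with remainder `r_n(K)`. -/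
theorem one_sub_residualPoly (n : ℕ) :
    1 - residualPoly n = ∑ j ∈ Finset.range n, X * residualPoly j ^ 2 := by
  induction n with
  | zero => simp [residualPoly]
  | succ n ih => rw [Finset.sum_range_succ, ← ih, residualPoly]; ring

section

variable {K : Module.End ℂ E} (hK : IsSymm A K) (h0 : PolyNonneg A K X)
  (h1 : PolyNonneg A K (1 - X))
include hK h0 h1

/-- `r_{n+1} = (r_n - r_n²) + (1 - X) r_n²` and `1 - r_{n+1} = (1 - r_n) + X r_n²`. -/
theorem polyNonneg_residualPoly (n : ℕ) :
    PolyNonneg A K (residualPoly n) ∧ PolyNonneg A K (1 - residualPoly n) := by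
  induction n with
  | zero =>
    refine ⟨?_, fun η => by simp [residualPoly]⟩
    have := polyNonneg_sq hK 1
    rwa [one_pow] at this
  | succ n ih =>
    constructor
    · convert (PolyNonneg.sub_sq hK ih.1 ih.2).add (h1.mul_sq hK (residualPoly n)) using 1
      rw [residualPoly]; ring
    · convert ih.2.add (h0.mul_sq hK (residualPoly n)) using 1
      rw [residualPoly]; ring

/-- The terms `X r_j²` decrease, since consecutive ones differ by `(r_j + r_{j+1})(X r_j)²`. Hence
`n X r_n²` is at most their sum `1 - r_n ≤ 1`. -/
theorem polyNonneg_one_sub_mul_residualPoly (n : ℕ) :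
    PolyNonneg A K (1 - (n : ℤ[X]) * (X * residualPoly n ^ 2)) := by
  have hr := polyNonneg_residualPoly hK h0 h1
  have hn : ∀ (k : ℕ) {f : ℤ[X]}, PolyNonneg A K f → PolyNonneg A K ((k : ℤ[X]) * f) := by
    intro k f hf
    induction k with
    | zero => intro η; simp
    | succ k ih =>
      convert ih.add hf using 1
      push_cast; ring
  have key : PolyNonneg A K (1 - residualPoly n - (n : ℤ[X]) * (X * residualPoly n ^ 2)) := by
    induction n with
    | zero => intro η; simp [residualPoly]
    | succ n ih =>
      have h := ((hr n).1.add (hr (n + 1)).1).mul_sq hK (X * residualPoly n)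
      convert ih.add (hn (n + 1) h) using 1
      rw [residualPoly]; push_cast; ring
  convert key.add (hr n).1 using 1
  ring

end

/-- Approximation by `∑ θ_{ξ,ξ} ≤ 1` on a small family of vectors. -/
theorem exists_isBessel_of_sum_le_one (s : Finset E) (c : ℝ)
    (hs : ∑ y ∈ s, ‖c • y‖ ^ 2 ≤ 1) (n : ℕ) :
    ∃ (t : Finset (ℕ × E)) (f : ℕ × E → E), IsBessel A t f ∧
      ∀ y ∈ s, n * ‖c • y - frameOp A t f (c • y)‖ ^ 2 ≤ 1 := by
  set g : E → E := fun y => c • y with hg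
  set K := frameOp A s g with hKdef
  have hK : IsSymm A K := isSymm_frameOp s g
  have h0 : PolyNonneg A K X := polyNonneg_frameOp s g
  have hb : IsBessel A s g := by
    rw [isBessel_iff]
    intro η
    calc ∑ y ∈ s, (inn η (g y) * inn (g y) η : A) ≤ ∑ y ∈ s, ‖g y‖ ^ 2 • inn η η :=
          Finset.sum_le_sum fun y _ => inn_mul_inn_le _ _
      _ = (∑ y ∈ s, ‖g y‖ ^ 2) • inn η η := (Finset.sum_smul ..).symm
      _ ≤ (1 : ℝ) • inn η η := smul_le_smul_of_nonneg_right hs (inn_self_nonneg η)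
      _ = _ := one_smul _ _
  have h1 : PolyNonneg A K (1 - X) := hb.polyNonneg
  have hsum : ∀ (j : ℕ) (x y : E), ∑ l ∈ s, (inn x (aeval K (residualPoly j) (g l)) *
      inn (aeval K (residualPoly j) (g l)) y : A) = inn x (aeval K (X * residualPoly j ^ 2) y) := by
    intro j x y
    rw [inn_aeval_mul_sq hK, aeval_X, inn_frameOp]
    refine Finset.sum_congr rfl fun l _ => ?_
    rw [hK.aeval, hK.aeval]
  have hop : frameOp A (Finset.range n ×ˢ s) (fun z => aeval K (residualPoly z.1) (g z.2)) =
      1 - aeval K (residualPoly n) := by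
    refine LinearMap.ext fun y => eq_of_forall_inn A fun x => ?_
    rw [inn_frameOp, Finset.sum_product]
    simp only [hsum]
    rw [← inn_sum_right, ← LinearMap.sum_apply, ← map_sum, ← one_sub_residualPoly, map_sub, map_one]
  refine ⟨Finset.range n ×ˢ s, fun z => aeval K (residualPoly z.1) (g z.2), fun η => ?_,
    fun y hy => ?_⟩
  · change (inn η (frameOp A (Finset.range n ×ˢ s) _ η) : A) ≤ _
    rw [hop, LinearMap.sub_apply, Module.End.one_apply, inn_sub_right]
    exact sub_le_self _ ((polyNonneg_residualPoly hK h0 h1 n).1 η)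
  · rw [hop, LinearMap.sub_apply, Module.End.one_apply, sub_sub_cancel]
    set z := aeval K (residualPoly n) (c • y) with hz
    -- `θ_{z,z}` is one summand of `K r_n(K)² ≤ 1/n`; evaluating at `z` itself and taking norms
    -- gives `n‖z‖⁴ ≤ ‖z‖²`.
    have h2 : n • (inn z z * inn z z : A) ≤ inn z z := by
      have h3 : (inn z z * inn z z : A) ≤ inn z (aeval K (X * residualPoly n ^ 2) z) := by
        rw [← hsum]
        exact Finset.single_le_sum (f := fun l => (inn z (aeval K (residualPoly n) (g l)) *
          inn (aeval K (residualPoly n) (g l)) z : A)) (fun l _ => inn_mul_inn_nonneg _ _) hy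
      refine (nsmul_le_nsmul_right h3 n).trans ?_
      have h4 := polyNonneg_one_sub_mul_residualPoly hK h0 h1 n z
      rw [map_sub, map_one, LinearMap.sub_apply, Module.End.one_apply, inn_sub_right, sub_nonneg,
        map_mul, map_natCast, Module.End.mul_apply, Module.End.natCast_apply] at h4
      rw [← Nat.cast_smul_eq_nsmul ℂ] at h4 ⊢
      rwa [inn_smul_right] at h4
    have h5 := CStarAlgebra.norm_le_norm_of_nonneg_of_le
      (nsmul_nonneg (inn_mul_inn_nonneg z z) n) h2
    have h6 : ‖(inn z z * inn z z : A)‖ = ‖z‖ ^ 2 * ‖z‖ ^ 2 := by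
      have := CStarRing.norm_star_mul_self (x := (inn z z : A))
      rwa [star_inn, ← norm_sq] at this
    rw [← Nat.cast_smul_eq_nsmul ℝ, norm_smul, h6, ← norm_sq, Real.norm_natCast] at h5
    rcases (sq_nonneg ‖z‖).eq_or_lt with h | h
    · rw [← h]; simp
    · rw [← mul_assoc] at h5
      exact (mul_le_iff_le_one_left h).1 h5

variable (A E) in
/-- An approximate unit of the form `∑ θ_{ξ,ξ} ≤ 1`. -/
theorem exists_approx_unit : ∃ u : Finset E × ℕ → Finset E,
    (∀ i, IsBessel A (u i) fun ξ => ξ) ∧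
    ∀ y, Tendsto (fun i => frameOp A (u i) (fun ξ => ξ) y) atTop (𝓝 y) := by
  have key : ∀ i : Finset E × ℕ, ∃ H : Finset E, IsBessel A H (fun ξ => ξ) ∧
      ∀ y ∈ i.1, ‖frameOp A H (fun ξ => ξ) y - y‖ ≤ 1 / ((i.2 : ℝ) + 1) := by
    rintro ⟨s, m⟩
    set B := ∑ y ∈ s, ‖y‖ ^ 2 with hB
    have hB0 : 0 ≤ B := Finset.sum_nonneg fun _ _ => sq_nonneg _
    -- Scaling makes `c²B ≤ 1`; its effect on the error is repaid by taking `n ≥ (m + 1)²/c²`.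
    set c : ℝ := (1 + B)⁻¹ with hc
    have hc0 : 0 < c := by positivity
    have hs : ∑ y ∈ s, ‖c • y‖ ^ 2 ≤ 1 := by
      simp only [norm_smul, mul_pow, ← Finset.mul_sum, ← hB, Real.norm_eq_abs, sq_abs]
      rw [hc, inv_pow, inv_mul_le_iff₀ (by positivity)]
      nlinarith
    obtain ⟨n, hn⟩ := exists_nat_ge (((m : ℝ) + 1) ^ 2 / c ^ 2)
    obtain ⟨t, f, hb, hf⟩ := exists_isBessel_of_sum_le_one (A := A) s c hs n
    obtain ⟨H, hH, -⟩ := exists_finset_frameOp_eq (A := A) (0 : A →L[ℂ] ℂ) 0 t f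
    refine ⟨H, fun η => ?_, fun y hy => ?_⟩
    · have := hb η
      change (inn η (frameOp A H (fun ξ => ξ) η) : A) ≤ _
      rw [hH]
      exact this
    · have h1 := hf y hy
      have h2 : c • y - frameOp A t f (c • y) = ((c : ℝ) : ℂ) • (y - frameOp A t f y) := by
        rw [smul_sub, ← map_smul]; rfl
      rw [h2, norm_smul, mul_pow, Complex.norm_real, Real.norm_eq_abs, sq_abs, norm_sub_rev] at h1
      rw [hH, le_div_iff₀ (by positivity)]
      rw [div_le_iff₀ (by positivity)] at hn
      refine (sq_le_one_iff₀ (by positivity)).1 ?_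
      calc (‖frameOp A t f y - y‖ * ((m : ℝ) + 1)) ^ 2
          = ((m : ℝ) + 1) ^ 2 * ‖frameOp A t f y - y‖ ^ 2 := by ring
        _ ≤ (n * c ^ 2) * ‖frameOp A t f y - y‖ ^ 2 := by gcongr
        _ ≤ 1 := by rw [mul_assoc]; exact h1
  choose u hu hu' using key
  refine ⟨u, hu, fun y => ?_⟩
  rw [tendsto_iff_norm_sub_tendsto_zero]
  have h1 : Tendsto (fun i : Finset E × ℕ => 1 / ((i.2 : ℝ) + 1)) atTop (𝓝 0) := by
    rw [← prod_atTop_atTop_eq]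
    exact tendsto_one_div_add_atTop_nhds_zero_nat.comp tendsto_snd
  refine squeeze_zero' (.of_forall fun _ => norm_nonneg _) ?_ h1
  filter_upwards [eventually_ge_atTop (({y}, 0) : Finset E × ℕ)] with i hi
  exact hu' i y (hi.1 (Finset.mem_singleton_self y))

/-! ### Induced traces -/

theorem _root_.IsTracialState.re_mono {τ : A →L[ℂ] ℂ} (hτ : IsTracialState τ) {a b : A}
    (h : a ≤ b) : (τ a).re ≤ (τ b).re := by
  have := (hτ.nonneg (b - a) (sub_nonneg.2 h)).1
  rw [map_sub, Complex.sub_re] at this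
  linarith

omit [StarOrderedRing A] in
theorem IsBessel.le_inducedTrace {ι : Type*} {s : Finset ι} {f : ι → E} (h : IsBessel A s f)
    (τ : A →L[ℂ] ℂ) (a : A) :
    ENNReal.ofReal (∑ i ∈ s, (τ (inn (f i) (lact a (f i)))).re) ≤ inducedTrace E τ a := by
  obtain ⟨H, hH, hs⟩ := exists_finset_frameOp_eq τ a s f
  rw [← hs]
  refine le_iSup₂_of_le H (fun η => ?_) le_rfl
  change (inn η (frameOp A H (fun ξ => ξ) η) : A) ≤ _
  rw [hH]
  exact h η

/-- The trace property `Tr(R R*) ≤ Tr(R* R)` of induced traces. -/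
theorem ofReal_sum_adjoint_le_inducedTrace {τ : A →L[ℂ] ℂ} (hτ : IsTracialState τ)
    {R : E → F} {R' : F → E} (hR : ∀ x y, (inn (R x) y : A) = inn x (R' y)) {c : A}
    (hc : ∀ x, (inn x (lact c x) : A) = inn (R x) (R x)) {G : Finset F}
    (hG : IsBessel A G fun ζ => ζ) :
    ENNReal.ofReal (∑ ζ ∈ G, (τ (inn (R' ζ) (R' ζ))).re) ≤ inducedTrace E τ c := by
  classical
  obtain ⟨u, hu, hu'⟩ := exists_approx_unit A E
  have hR' : ∀ x y, (inn (R' y) x : A) = inn y (R x) := fun x y => by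
    rw [← star_inn, ← hR, star_inn]
  have hlim : Tendsto (fun i => ENNReal.ofReal
      (∑ ζ ∈ G, (τ (inn (R' ζ) (frameOp A (u i) (fun ξ => ξ) (R' ζ)))).re)) atTop
      (𝓝 (ENNReal.ofReal (∑ ζ ∈ G, (τ (inn (R' ζ) (R' ζ))).re))) := by
    refine ENNReal.tendsto_ofReal (tendsto_finsetSum _ fun ζ _ => ?_)
    exact ((Complex.continuous_re.comp (τ.continuous.comp
      (continuous_inn_right A (R' ζ)))).tendsto _).comp (hu' (R' ζ))
  refine le_of_tendsto' hlim fun i => le_trans (ENNReal.ofReal_le_ofReal ?_)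
    ((hu i).le_inducedTrace τ c)
  -- With an approximate unit of `E` inserted, the trace swaps the two inner products; what remains
  -- is `∑ θ_{ζ,ζ}` evaluated at `Rξ`, at most `⟨Rξ, Rξ⟩`.
  calc ∑ ζ ∈ G, (τ (inn (R' ζ) (frameOp A (u i) (fun ξ => ξ) (R' ζ)))).re
      = ∑ ξ ∈ u i, (τ (∑ ζ ∈ G, inn (R ξ) ζ * inn ζ (R ξ))).re := by
        simp only [inn_frameOp, map_sum, Complex.re_sum]
        rw [Finset.sum_comm]
        refine Finset.sum_congr rfl fun ξ _ => Finset.sum_congr rfl fun ζ _ => ?_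
        rw [hτ.trace, hR', hR]
    _ ≤ ∑ ξ ∈ u i, (τ (inn ξ (lact c ξ))).re := by
        refine Finset.sum_le_sum fun ξ _ => hτ.re_mono ?_
        rw [hc]
        exact isBessel_iff.1 hG (R ξ)

end CStarCorrespondence

/-! ### Product systems -/

namespace ProductSystem

open Filter Topology

variable {A P : Type*} [Monoid P] {X : P → Type*} [NonUnitalCStarAlgebra A] [PartialOrder A]
  [∀ p, NormedAddCommGroup (X p)] [∀ p, NormedSpace ℂ (X p)] [∀ p, CompleteSpace (X p)]
  [∀ p, CStarCorrespondence A (X p)] (Y : ProductSystem A X) {p q : P}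

/-- Associativity with first factor in `X 1`. The chain runs in the total space, since the
intermediate products lie over different expressions for `p * q`. -/
theorem lact_mul (a : A) (ξ : X p) (ζ : X q) : lact a (Y.mul ξ ζ) = Y.mul (lact a ξ) ζ := by
  have h1 := Y.unit_mul a (Y.mul ξ ζ)
  have h2 := congrArg (fun z : Σ p, X p => (⟨z.1 * q, Y.mul z.2 ζ⟩ : Σ p, X p)) (Y.unit_mul a ξ)
  have h3 := h1.symm.trans ((Y.mul_assoc _ _ _).symm.trans h2)
  exact eq_of_heq (Sigma.mk.inj h3).2

theorem ract_mul (a : A) (ξ : X p) (ζ : X q) : Y.mul (ract a ξ) ζ = Y.mul ξ (lact a ζ) := by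
  have h1 := congrArg (fun z : Σ p, X p => (⟨z.1 * q, Y.mul z.2 ζ⟩ : Σ p, X p)) (Y.mul_unit a ξ)
  have h2 := congrArg (fun z : Σ p, X p => (⟨p * z.1, Y.mul ξ z.2⟩ : Σ p, X p)) (Y.unit_mul a ζ)
  have h3 := h1.symm.trans ((Y.mul_assoc _ _ _).trans h2)
  exact eq_of_heq (Sigma.mk.inj h3).2

variable [StarOrderedRing A]

theorem norm_mul_le (ξ : X p) (ζ : X q) : ‖Y.mul ξ ζ‖ ≤ ‖ξ‖ * ‖ζ‖ := by
  rw [← pow_le_pow_iff_left₀ (norm_nonneg _) (by positivity) two_ne_zero, norm_sq (A := A),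
    Y.inn_mul]
  calc _ ≤ ‖ζ‖ * (‖(inn ξ ξ : A)‖ * ‖ζ‖) :=
        (norm_inn_le A _ _).trans (by gcongr; exact norm_lact_le _ _)
    _ = _ := by rw [← norm_sq]; ring

/-! ### Adjoints of multiplication operators and amplified frame operators. -/

theorem norm_le_of_adjoint {ξ : X p} {y : X (p * q)} {w : X q}
    (h : ∀ ζ : X q, (inn (Y.mul ξ ζ) y : A) = inn ζ w) : ‖w‖ ≤ ‖ξ‖ * ‖y‖ := by
  have h1 : ‖w‖ ^ 2 ≤ ‖ξ‖ * ‖w‖ * ‖y‖ := by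
    rw [norm_sq (A := A), ← h]
    exact (norm_inn_le A _ _).trans (by gcongr; exact Y.norm_mul_le _ _)
  rcases (norm_nonneg w).eq_or_lt with hw | hw
  · rw [← hw]; positivity
  · nlinarith

/-- On a product `ξ'ζ'` the value is `⟨ξ, ξ'⟩ζ'`. The norm bound and completeness of `X q` extend
this from the dense span of products; density is the reason for `p ≠ 1`. -/
theorem exists_adjoint (hp : p ≠ 1) (ξ : X p) (y : X (p * q)) :
    ∃ w : X q, ∀ ζ : X q, (inn (Y.mul ξ ζ) y : A) = inn ζ w := by
  let V : Submodule ℂ (X (p * q)) :=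
    { carrier := {y | ∃ w : X q, ∀ ζ : X q, (inn (Y.mul ξ ζ) y : A) = inn ζ w}
      zero_mem' := ⟨0, fun ζ => by simp⟩
      add_mem' := by
        rintro y y' ⟨w, hw⟩ ⟨w', hw'⟩
        exact ⟨w + w', fun ζ => by rw [inn_add_right, inn_add_right, hw, hw']⟩
      smul_mem' := by
        rintro c y ⟨w, hw⟩
        exact ⟨c • w, fun ζ => by rw [inn_smul_right, inn_smul_right, hw]⟩ }
  have hV : Submodule.span ℂ {x | ∃ (ξ : X p) (ζ : X q), Y.mul ξ ζ = x} ≤ V := by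
    rw [Submodule.span_le]
    rintro _ ⟨ξ', ζ', rfl⟩
    exact ⟨lact (inn ξ ξ' : A) ζ', fun ζ => Y.inn_mul _ _ _ _⟩
  obtain ⟨v, hv, hvy⟩ := mem_closure_iff_seq_limit.1 (Y.dense_mul p q hp y)
  choose w hw using fun n => hV (hv n)
  have hd : ∀ m n, dist (w m) (w n) ≤ ‖ξ‖ * dist (v m) (v n) := fun m n => by
    rw [dist_eq_norm, dist_eq_norm]
    exact Y.norm_le_of_adjoint fun ζ => by rw [inn_sub_right, inn_sub_right, hw, hw]
  have hc : CauchySeq w := by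
    rw [Metric.cauchySeq_iff']
    intro ε hε
    obtain ⟨N, hN⟩ := Metric.cauchySeq_iff'.1 hvy.cauchySeq (ε / (‖ξ‖ + 1)) (by positivity)
    refine ⟨N, fun n hn => (hd n N).trans_lt ?_⟩
    have := hN n hn
    rw [lt_div_iff₀ (by positivity)] at this
    nlinarith [dist_nonneg (x := v n) (y := v N), norm_nonneg ξ]
  obtain ⟨w', hw'⟩ := cauchySeq_tendsto_of_complete hc
  refine ⟨w', fun ζ => tendsto_nhds_unique
    (((continuous_inn_right A (Y.mul ξ ζ)).tendsto y).comp hvy) ?_⟩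
  refine (((continuous_inn_right A ζ).tendsto w').comp hw').congr fun n => ?_
  exact (hw n ζ).symm

/-- The adjoint of `ζ ↦ ξ ζ`. -/
noncomputable def adj (hp : p ≠ 1) (ξ : X p) : X (p * q) →ₗ[ℂ] X q where
  toFun y := (Y.exists_adjoint hp ξ y).choose
  map_add' y y' := eq_of_forall_inn A fun ζ => by
    rw [inn_add_right, ← (Y.exists_adjoint hp ξ _).choose_spec ζ,
      ← (Y.exists_adjoint hp ξ _).choose_spec ζ, ← (Y.exists_adjoint hp ξ _).choose_spec ζ,
      inn_add_right]
  map_smul' c y := eq_of_forall_inn A fun ζ => by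
    rw [RingHom.id_apply, inn_smul_right, ← (Y.exists_adjoint hp ξ _).choose_spec ζ,
      ← (Y.exists_adjoint hp ξ _).choose_spec ζ, inn_smul_right]

theorem inn_mul_left (hp : p ≠ 1) (ξ : X p) (ζ : X q) (y : X (p * q)) :
    (inn (Y.mul ξ ζ) y : A) = inn ζ (Y.adj hp ξ y) :=
  (Y.exists_adjoint hp ξ y).choose_spec ζ

theorem inn_mul_right (hp : p ≠ 1) (ξ : X p) (ζ : X q) (y : X (p * q)) :
    (inn y (Y.mul ξ ζ) : A) = inn (Y.adj hp ξ y) ζ := by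
  rw [← star_inn, Y.inn_mul_left hp, star_inn]

theorem adj_mul (hp : p ≠ 1) (ξ ξ' : X p) (ζ : X q) :
    Y.adj hp ξ (Y.mul ξ' ζ) = lact (inn ξ ξ' : A) ζ :=
  eq_of_forall_inn A fun z => by rw [← Y.inn_mul_left hp, Y.inn_mul]

/-- The operator `∑_{ξ ∈ H} θ_{ξ,ξ} ⊗ 1` on `X (p * q)`. -/
noncomputable def ampl (hp : p ≠ 1) (q : P) (H : Finset (X p)) : Module.End ℂ (X (p * q)) :=
  ∑ ξ ∈ H, Y.mul ξ ∘ₗ Y.adj hp ξ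

section

variable (hp : p ≠ 1) (H : Finset (X p))

theorem inn_ampl (x y : X (p * q)) :
    (inn x (Y.ampl hp q H y) : A) = ∑ ξ ∈ H, inn (Y.adj hp ξ x) (Y.adj hp ξ y) := by
  simp only [ampl, LinearMap.sum_apply, LinearMap.comp_apply, inn_sum_right, Y.inn_mul_right hp]

theorem isSymm_ampl : IsSymm A (Y.ampl hp q H) := fun x y => by
  rw [← star_inn, inn_ampl, inn_ampl, star_sum]
  simp only [star_inn]

theorem ampl_mul (ξ : X p) (ζ : X q) :
    Y.ampl hp q H (Y.mul ξ ζ) = Y.mul (frameOp A H (fun ξ => ξ) ξ) ζ := by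
  simp only [ampl, LinearMap.sum_apply, LinearMap.comp_apply, Y.adj_mul hp, frameOp,
    LinearMap.coe_mk, AddHom.coe_mk, map_sum, rankOne, Y.ract_mul]

theorem ampl_pow_mul (m : ℕ) (ξ : X p) (ζ : X q) :
    (Y.ampl hp q H ^ m) (Y.mul ξ ζ) = Y.mul ((frameOp A H (fun ξ => ξ) ^ m) ξ) ζ := by
  induction m generalizing ξ with
  | zero => simp
  | succ m ih => rw [pow_succ, pow_succ, Module.End.mul_apply, Module.End.mul_apply, ampl_mul, ih]

theorem continuous_ampl : Continuous (Y.ampl hp q H) := by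
  refine AddMonoidHomClass.continuous_of_bound (Y.ampl hp q H) (∑ ξ ∈ H, ‖ξ‖ * ‖ξ‖) fun y => ?_
  rw [ampl, LinearMap.sum_apply, Finset.sum_mul]
  refine norm_sum_le_of_le _ fun ξ _ => (Y.norm_mul_le _ _).trans ?_
  rw [_root_.mul_assoc]
  gcongr
  exact Y.norm_le_of_adjoint fun ζ => Y.inn_mul_left hp ξ ζ y

variable {H} (hH : IsBessel A H fun ξ => ξ)
include hH

/-- On a finite sum of products the powers of `T ⊗ 1` are bounded because `T` is a contraction, so
`inn_apply_le_of_pow_bounded` applies there. The inequality is a closed condition on `y`. -/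
theorem inn_ampl_le (y : X (p * q)) : (inn y (Y.ampl hp q H y) : A) ≤ inn y y := by
  have hcl : IsClosed {y : X (p * q) | (inn y (Y.ampl hp q H y) : A) ≤ inn y y} :=
    isClosed_le (continuous_inn A continuous_id (Y.continuous_ampl hp H))
      (continuous_inn A continuous_id continuous_id)
  refine hcl.closure_subset_iff.2 (fun y hy => ?_) (Y.dense_mul p q hp y)
  suffices h : ∃ C, ∀ m : ℕ, ‖(Y.ampl hp q H ^ m) y‖ ≤ C by
    obtain ⟨C, hC⟩ := h
    exact inn_apply_le_of_pow_bounded (Y.isSymm_ampl hp H) hC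
  induction hy using Submodule.span_induction with
  | mem y hy =>
    obtain ⟨ξ, ζ, rfl⟩ := hy
    refine ⟨‖ξ‖ * ‖ζ‖, fun m => ?_⟩
    rw [ampl_pow_mul]
    refine (Y.norm_mul_le _ _).trans (mul_le_mul_of_nonneg_right ?_ (norm_nonneg ζ))
    induction m with
    | zero => simp
    | succ m ih =>
      rw [pow_succ', Module.End.mul_apply]
      exact (hH.norm_frameOp_le _).trans ih
  | zero => exact ⟨0, fun m => by simp⟩
  | add y y' _ _ h h' =>
    obtain ⟨C, hC⟩ := h
    obtain ⟨C', hC'⟩ := h'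
    exact ⟨C + C', fun m => by rw [map_add]; exact (norm_add_le _ _).trans (add_le_add (hC m) (hC' m))⟩
  | smul c y _ h =>
    obtain ⟨C, hC⟩ := h
    exact ⟨‖c‖ * C, fun m => by rw [map_smul, norm_smul]; gcongr; exact hC m⟩

theorem norm_ampl_le (y : X (p * q)) : ‖Y.ampl hp q H y‖ ≤ ‖y‖ := by
  refine norm_apply_le_of_polyNonneg (Y.isSymm_ampl hp H) (fun η => ?_) (fun η => ?_) y
  · rw [Polynomial.aeval_X, inn_ampl]
    exact Finset.sum_nonneg fun ξ _ => inn_self_nonneg _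
  · rw [map_sub, map_one, Polynomial.aeval_X, LinearMap.sub_apply, inn_sub_right, sub_nonneg]
    exact Y.inn_ampl_le hp hH η

end

theorem tendsto_ampl (hp : p ≠ 1) {ι : Type*} {l : Filter ι} {u : ι → Finset (X p)}
    (hu : ∀ i, IsBessel A (u i) fun ξ => ξ)
    (hu' : ∀ ξ, Tendsto (fun i => frameOp A (u i) (fun ξ => ξ) ξ) l (𝓝 ξ)) (y : X (p * q)) :
    Tendsto (fun i => Y.ampl hp q (u i) y) l (𝓝 y) := by
  have hspan : ∀ y ∈ Submodule.span ℂ {x : X (p * q) | ∃ (ξ : X p) (ζ : X q), Y.mul ξ ζ = x},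
      Tendsto (fun i => Y.ampl hp q (u i) y) l (𝓝 y) := by
    intro y hy
    induction hy using Submodule.span_induction with
    | mem y hy =>
      obtain ⟨ξ, ζ, rfl⟩ := hy
      simp only [ampl_mul]
      have hc : Continuous fun ξ : X p => Y.mul ξ ζ :=
        AddMonoidHomClass.continuous_of_bound (Y.mul.flip ζ) ‖ζ‖ fun ξ => by
          rw [mul_comm]; exact Y.norm_mul_le ξ ζ
      exact (hc.tendsto ξ).comp (hu' ξ)
    | zero => simpa using tendsto_const_nhds
    | add y y' _ _ h h' => simpa only [map_add] using h.add h'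
    | smul c y _ h => simpa only [map_smul] using h.const_smul c
  rw [Metric.tendsto_nhds]
  intro ε hε
  obtain ⟨y', hy', hd⟩ := Metric.mem_closure_iff.1 (Y.dense_mul p q hp y) (ε / 3) (by positivity)
  filter_upwards [Metric.tendsto_nhds.1 (hspan y' hy') (ε / 3) (by positivity)] with i hi
  have h1 : dist (Y.ampl hp q (u i) y) (Y.ampl hp q (u i) y') ≤ dist y y' := by
    rw [dist_eq_norm, dist_eq_norm, ← map_sub]
    exact Y.norm_ampl_le hp (hu i) _
  have := dist_triangle4 (Y.ampl hp q (u i) y) (Y.ampl hp q (u i) y') y' y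
  rw [dist_comm y' y] at this
  linarith

/-! ### Induction of traces in stages -/

theorem _root_.ENNReal.sum_iSup_le {α ι : Type*} [Nonempty ι] (s : Finset α) (g : α → ι → ℝ≥0∞)
    (c : ℝ≥0∞) (h : ∀ G : α → ι, ∑ a ∈ s, g a (G a) ≤ c) : ∑ a ∈ s, ⨆ i, g a i ≤ c := by
  classical
  -- The extra summand `b` absorbs the values already chosen, so the suprema come out one at a time.
  suffices H : ∀ b : ℝ≥0∞, (∀ G : α → ι, b + ∑ a ∈ s, g a (G a) ≤ c) →
      b + ∑ a ∈ s, ⨆ i, g a i ≤ c by simpa using H 0 (by simpa using h)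
  clear h
  induction s using Finset.induction_on with
  | empty => intro b h; simpa using h
  | insert a s ha ih =>
    intro b h
    rw [Finset.sum_insert ha, ← add_assoc, ENNReal.add_iSup, ENNReal.iSup_add]
    refine iSup_le fun i => ih (b + g a i) fun G => ?_
    have := h (Function.update G a i)
    rw [Finset.sum_insert ha, Function.update_self, ← add_assoc] at this
    convert this using 2
    refine Finset.sum_congr rfl fun x hx => ?_
    rw [Function.update_of_ne (ne_of_mem_of_not_mem hx ha)]

omit [StarOrderedRing A] in
theorem inducedTrace_eq_iSup (E : Type*) [NormedAddCommGroup E] [NormedSpace ℂ E]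
    [CompleteSpace E] [CStarCorrespondence A E] (τ : A →L[ℂ] ℂ) (a : A) :
    inducedTrace E τ a = ⨆ H : {H : Finset E // IsBessel A H fun ξ => ξ},
      ENNReal.ofReal (∑ ξ ∈ H.1, (τ (inn ξ (lact a ξ))).re) := by
  rw [iSup_subtype]; rfl

omit [StarOrderedRing A] in
theorem inn_mul_lact_mul (a : A) (ξ : X p) (ζ : X q) :
    (inn (Y.mul ξ ζ) (lact a (Y.mul ξ ζ)) : A) = inn ζ (lact (inn ξ (lact a ξ) : A) ζ) := by
  rw [Y.lact_mul, Y.inn_mul]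

variable {τ : A →L[ℂ] ℂ} (hτ : IsTracialState τ)

include hτ in
omit [StarOrderedRing A] in
theorem re_inn_lact_nonneg {E : Type*} [NormedAddCommGroup E] [NormedSpace ℂ E]
    [CompleteSpace E] [CStarCorrespondence A E] {a b : A} (hb : star b = b) (hab : b * b = a)
    (ξ : E) : 0 ≤ (τ (inn ξ (lact a ξ))).re := by
  rw [← hab, CStarCorrespondence.lact_mul, inn_lact_right, hb]
  exact (hτ.nonneg _ (inn_self_nonneg _)).1

include Y hτ

/-- If `H` is Bessel and each `G ξ` is Bessel, the products `ξζ` with `ζ ∈ G ξ` form a Bessel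
family, being dominated by the amplification of `∑ θ_{ξ,ξ}`. The `G ξ` vary independently. -/
theorem sum_inducedTrace_le (hp : p ≠ 1) {H : Finset (X p)} (hH : IsBessel A H fun ξ => ξ)
    {a b : A} (hb : star b = b) (hab : b * b = a) :
    ∑ ξ ∈ H, inducedTrace (X q) τ (inn ξ (lact a ξ)) ≤ inducedTrace (X (p * q)) τ a := by
  have : Nonempty {H : Finset (X q) // IsBessel A H fun ξ => ξ} :=
    ⟨⟨∅, fun η => by simpa using inn_self_nonneg η⟩⟩
  simp only [inducedTrace_eq_iSup (X q)]
  refine ENNReal.sum_iSup_le _ _ _ fun G => ?_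
  have hbes : IsBessel A (H.sigma fun ξ => (G ξ).1) (fun z => Y.mul z.1 z.2) := by
    rw [isBessel_iff]
    intro η
    refine le_trans ?_ (Y.inn_ampl_le hp hH η)
    rw [Finset.sum_sigma, inn_ampl]
    refine Finset.sum_le_sum fun ξ _ => ?_
    simp only [Y.inn_mul_left hp, Y.inn_mul_right hp]
    exact isBessel_iff.1 (G ξ).2 _
  refine le_trans (le_of_eq ?_) (hbes.le_inducedTrace τ a)
  rw [Finset.sum_sigma, ENNReal.ofReal_sum_of_nonneg]
  · simp only [inn_mul_lact_mul]
  · exact fun ξ _ => Finset.sum_nonneg fun ζ _ => re_inn_lact_nonneg hτ hb hab _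

theorem tendsto_sum_inducedTrace (hp : p ≠ 1) {ι : Type*} {l : Filter ι} {u : ι → Finset (X p)}
    (hu : ∀ i, IsBessel A (u i) fun ξ => ξ)
    (hu' : ∀ ξ, Tendsto (fun i => frameOp A (u i) (fun ξ => ξ) ξ) l (𝓝 ξ)) (q : P)
    {a b : A} (hb : star b = b) (hab : b * b = a) :
    Tendsto (fun i => ∑ ξ ∈ u i, inducedTrace (X q) τ (inn ξ (lact a ξ))) l
      (𝓝 (inducedTrace (X (p * q)) τ a)) := by
  refine tendsto_order.2 ⟨fun c hc => ?_, fun c hc => .of_forall fun i =>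
    (Y.sum_inducedTrace_le hτ hp (hu i) hb hab).trans_lt hc⟩
  rw [inducedTrace_eq_iSup] at hc
  obtain ⟨⟨G, hG⟩, hc⟩ := lt_iSup_iff.1 hc
  have hlim : Tendsto (fun i => ENNReal.ofReal
      (∑ ζ ∈ G, (τ (inn (lact b ζ) (Y.ampl hp q (u i) (lact b ζ)))).re)) l
      (𝓝 (ENNReal.ofReal (∑ ζ ∈ G, (τ (inn (lact b ζ) (lact b ζ))).re))) := by
    refine ENNReal.tendsto_ofReal (tendsto_finsetSum _ fun ζ _ => ?_)
    exact ((Complex.continuous_re.comp (τ.continuous.comp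
      (continuous_inn_right A (lact b ζ)))).tendsto _).comp (Y.tendsto_ampl hp hu hu' (lact b ζ))
  have hc' : c < ENNReal.ofReal (∑ ζ ∈ G, (τ (inn (lact b ζ) (lact b ζ))).re) := by
    simpa only [← hab, CStarCorrespondence.lact_mul, inn_lact_right, hb] using hc
  filter_upwards [(tendsto_order.1 hlim).1 c hc'] with i hi
  refine hi.trans_le ?_
  simp only [inn_ampl, map_sum, Complex.re_sum]
  rw [Finset.sum_comm, ENNReal.ofReal_sum_of_nonneg fun ξ _ => Finset.sum_nonneg fun ζ _ =>
    (hτ.nonneg _ (inn_self_nonneg _)).1]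
  refine Finset.sum_le_sum fun ξ _ => ?_
  -- With `b² = a`, left multiplication by `bξ` satisfies `R*R = ⟨bξ, bξ⟩ = ⟨ξ, aξ⟩`, so the trace
  -- property bounds the `ξ`-part by `Tr^q(⟨ξ, aξ⟩)`.
  refine ofReal_sum_adjoint_le_inducedTrace hτ (R := fun x => Y.mul (lact b ξ) x)
    (R' := fun y => Y.adj hp ξ (lact b y)) (fun x y => ?_) (fun x => ?_) hG
  · rw [← Y.lact_mul, inn_lact, hb, Y.inn_mul_left hp]
  · rw [Y.inn_mul, inn_lact, hb, ← CStarCorrespondence.lact_mul, hab]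

/-- By traciality the defining sum is `τ(⟨b, Tb⟩)` with `T = ∑ θ_{ξ,ξ}` and `b` viewed in `X 1`;
then `T ≤ 1` gives one bound and `T → 1` the other. -/
theorem inducedTrace_one {a b : A} (hb : star b = b) (hab : b * b = a) :
    inducedTrace (X 1) τ a = ENNReal.ofReal (τ a).re := by
  classical
  have hin : (inn (Y.unit b) (Y.unit b) : A) = a := by rw [Y.inn_unit, hb, hab]
  have key : ∀ H : Finset (X 1), (τ (inn (Y.unit b) (frameOp A H (fun ξ => ξ) (Y.unit b)))).re =
      ∑ ξ ∈ H, (τ (inn ξ (lact a ξ))).re := by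
    intro H
    rw [inn_frameOp, map_sum, Complex.re_sum]
    refine Finset.sum_congr rfl fun ξ _ => ?_
    obtain ⟨c, rfl⟩ := Y.unit.surjective ξ
    rw [hτ.trace, Y.inn_unit, Y.inn_unit, Y.lact_unit, Y.inn_unit, ← hab, hb]
    simp only [_root_.mul_assoc]
  apply le_antisymm
  · refine iSup₂_le fun H hH => ENNReal.ofReal_le_ofReal ?_
    rw [← key, ← hin]
    exact hτ.re_mono (hH (Y.unit b))
  · obtain ⟨u, hu, hu'⟩ := exists_approx_unit A (X 1)
    have hlim : Tendsto (fun i => ENNReal.ofReal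
        (τ (inn (Y.unit b) (frameOp A (u i) (fun ξ => ξ) (Y.unit b)))).re) atTop
        (𝓝 (ENNReal.ofReal (τ (inn (Y.unit b) (Y.unit b))).re)) :=
      ENNReal.tendsto_ofReal (((Complex.continuous_re.comp (τ.continuous.comp
        (continuous_inn_right A (Y.unit b)))).tendsto _).comp (hu' (Y.unit b)))
    rw [hin] at hlim
    refine le_of_tendsto' hlim fun i => ?_
    rw [key]
    exact (hu i).le_inducedTrace τ a

end ProductSystem

/-! ### Alternating sums over intersections of right ideals -/

section Ideals

open Filter Topology

variable {P : Type*} [Monoid P]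

/-- The principal right ideal `x P`. -/
def multiples (x : P) : Set P := {y | x ∣ y}

open Classical in
/-- The value of `φ` at the generator of a right ideal, or `0` if the ideal is not principal. -/
noncomputable def idealVal (φ : P → ℝ) (I : Set P) : ℝ :=
  if h : ∃ r, I = multiples r then φ h.choose else 0

/-- The sum `∑_{K ⊆ s} (-1)^{|K|} φ(J ∩ ⋂_{k ∈ K} I k)`. -/
noncomputable def altSum {ι : Type*} (φ : P → ℝ) (J : Set P) (s : Finset ι) (I : ι → Set P) : ℝ :=
  ∑ K ∈ s.powerset, (-1) ^ K.card * idealVal φ (J ∩ ⋂ k ∈ K, I k)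

theorem idealVal_empty (φ : P → ℝ) : idealVal φ ∅ = 0 := by
  rw [idealVal, dif_neg]
  rintro ⟨r, hr⟩
  have : r ∈ multiples r := dvd_rfl
  rw [← hr] at this
  exact this

/-- The chosen generator depends on the ideal alone, so `idealVal` is linear and pointwise
continuous in the function. -/
theorem idealVal_sum {α : Type*} (s : Finset α) (f : α → P → ℝ) (I : Set P) :
    idealVal (fun x => ∑ a ∈ s, f a x) I = ∑ a ∈ s, idealVal (f a) I := by
  by_cases h : ∃ r, I = multiples r
  · simp only [idealVal, dif_pos h]
  · simp only [idealVal, dif_neg h, Finset.sum_const_zero]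

theorem idealVal_mul_left (c : ℝ) (f : P → ℝ) (I : Set P) :
    idealVal (fun x => c * f x) I = c * idealVal f I := by
  by_cases h : ∃ r, I = multiples r
  · simp only [idealVal, dif_pos h]
  · simp only [idealVal, dif_neg h, mul_zero]

theorem tendsto_idealVal {α : Type*} {l : Filter α} {f : α → P → ℝ} {g : P → ℝ}
    (h : ∀ x, Tendsto (fun i => f i x) l (𝓝 (g x))) (I : Set P) :
    Tendsto (fun i => idealVal (f i) I) l (𝓝 (idealVal g I)) := by
  by_cases hI : ∃ r, I = multiples r
  · simpa only [idealVal, dif_pos hI] using h _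
  · simpa only [idealVal, dif_neg hI] using tendsto_const_nhds

variable {ι : Type*} (φ : P → ℝ) (J : Set P) (I : ι → Set P)

theorem altSum_sum {α : Type*} (t : Finset α) (f : α → P → ℝ) (s : Finset ι) :
    altSum (fun x => ∑ a ∈ t, f a x) J s I = ∑ a ∈ t, altSum (f a) J s I := by
  simp only [altSum, idealVal_sum, Finset.mul_sum]
  exact Finset.sum_comm

theorem altSum_mul_left (c : ℝ) (s : Finset ι) :
    altSum (fun x => c * φ x) J s I = c * altSum φ J s I := by
  simp only [altSum, idealVal_mul_left, Finset.mul_sum]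
  exact Finset.sum_congr rfl fun _ _ => by ring

theorem tendsto_altSum {α : Type*} {l : Filter α} {f : α → P → ℝ} {g : P → ℝ}
    (h : ∀ x, Tendsto (fun i => f i x) l (𝓝 (g x))) (s : Finset ι) :
    Tendsto (fun i => altSum (f i) J s I) l (𝓝 (altSum g J s I)) :=
  tendsto_finsetSum _ fun _ _ => (tendsto_idealVal h _).const_mul _

theorem altSum_set_empty (s : Finset ι) : altSum φ ∅ s I = 0 := by
  simp [altSum, idealVal_empty]

theorem altSum_finset_empty : altSum φ J (∅ : Finset ι) I = idealVal φ J := by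
  simp [altSum]

variable {I} in
theorem altSum_congr {I' : ι → Set P} {s : Finset ι} (h : ∀ k ∈ s, I k = I' k) :
    altSum φ J s I = altSum φ J s I' := by
  refine Finset.sum_congr rfl fun K hK => ?_
  rw [Set.iInter₂_congr fun k hk => h k (Finset.mem_powerset.1 hK hk)]

variable [DecidableEq ι]

/-- The subsets are split according to whether they contain `k`. All later inclusion-exclusion rests
on this recursion. -/
theorem altSum_insert {k : ι} {s : Finset ι} (hk : k ∉ s) :
    altSum φ J (insert k s) I = altSum φ J s I - altSum φ (J ∩ I k) s I := by
  rw [altSum, Finset.sum_powerset_insert hk, altSum, altSum, sub_eq_add_neg, ← Finset.sum_neg_distrib]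
  congr 1
  refine Finset.sum_congr rfl fun K hK => ?_
  rw [Finset.card_insert_of_notMem fun h => hk (Finset.mem_powerset.1 hK h),
    Finset.set_biInter_insert, Set.inter_assoc, pow_succ]
  ring

variable {J} in
theorem altSum_eq_zero {k : ι} {s : Finset ι} (hk : k ∈ s) (h : J ⊆ I k) : altSum φ J s I = 0 := by
  rw [← Finset.insert_erase hk, altSum_insert _ _ _ (Finset.notMem_erase k s),
    Set.inter_eq_left.2 h, sub_self]

theorem altSum_image {κ : Type*} [DecidableEq κ] (f : κ → ι) (s : Finset κ) (hf : Set.InjOn f s) :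
    altSum φ J (s.image f) I = altSum φ J s (fun k => I (f k)) := by
  induction s using Finset.induction_on generalizing J with
  | empty => rw [Finset.image_empty, altSum_finset_empty, altSum_finset_empty]
  | insert k s hk ih =>
    have hf' : Set.InjOn f s := hf.mono (by simp)
    have hk' : f k ∉ s.image f := by
      intro h
      obtain ⟨l, hl, hlk⟩ := Finset.mem_image.1 h
      have := hf (by simp [hl]) (by simp) hlk
      exact hk (this ▸ hl)
    rw [Finset.image_insert, altSum_insert _ _ _ hk', altSum_insert _ _ _ hk, ih _ hf', ih _ hf']

end Ideals

/-! ### Descent of alternating sums to generators. -/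

namespace ArtinMonoid

open Filter Topology

variable {S : Type*} {M : CoxeterMatrix S}

theorem multiples_injective {x y : ArtinMonoid M} (h : multiples x = multiples y) : x = y := by
  refine dvd_antisymm' ?_ ?_
  · change y ∈ multiples x; rw [h]; exact dvd_rfl
  · change x ∈ multiples y; rw [← h]; exact dvd_rfl

theorem idealVal_multiples (φ : ArtinMonoid M → ℝ) (x : ArtinMonoid M) :
    idealVal φ (multiples x) = φ x := by
  have h : ∃ r, multiples x = multiples r := ⟨x, rfl⟩
  rw [idealVal, dif_pos h, ← multiples_injective h.choose_spec]

theorem multiples_one : multiples (1 : ArtinMonoid M) = Set.univ :=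
  Set.eq_univ_of_forall fun y => one_dvd y

variable (hM : IsRightAngled M) (φ : ArtinMonoid M → ℝ) (s : S)

theorem image_gen_mul_multiples (x : ArtinMonoid M) :
    (gen M s * ·) '' multiples x = multiples (gen M s * x) := by
  ext y
  constructor
  · rintro ⟨z, hz, rfl⟩
    exact mul_dvd_mul_left _ hz
  · rintro ⟨z, rfl⟩
    exact ⟨x * z, dvd_mul_right x z, (mul_assoc _ _ _).symm⟩

include hM in
theorem idealVal_image_gen_mul (I : Set (ArtinMonoid M)) :
    idealVal φ ((gen M s * ·) '' I) = idealVal (fun x => φ (gen M s * x)) I := by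
  have hinj : Function.Injective (gen M s * · : ArtinMonoid M → ArtinMonoid M) :=
    fun x y h => gen_mul_left_cancel hM h
  by_cases h : ∃ r, I = multiples r
  · obtain ⟨r, rfl⟩ := h
    rw [image_gen_mul_multiples, idealVal_multiples, idealVal_multiples]
  · have h' : ¬ ∃ r, (gen M s * ·) '' I = multiples r := by
      rintro ⟨r, hr⟩
      have hmem : r ∈ (gen M s * ·) '' I := by rw [hr]; exact dvd_rfl
      obtain ⟨z, -, rfl⟩ := hmem
      refine h ⟨z, hinj.image_injective ?_⟩
      rw [image_gen_mul_multiples]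
      exact hr
    rw [idealVal, dif_neg h', idealVal, dif_neg h]

-- `sJ ∩ ⋂ I_k = s(J ∩ ⋂ s⁻¹I_k)`, and left cancellation matches principal ideals on both sides.
include hM in
theorem altSum_image_gen_mul {ι : Type*} (J : Set (ArtinMonoid M)) (t : Finset ι)
    (I : ι → Set (ArtinMonoid M)) :
    altSum φ ((gen M s * ·) '' J) t I =
      altSum (fun x => φ (gen M s * x)) J t fun k => (gen M s * ·) ⁻¹' I k := by
  refine Finset.sum_congr rfl fun K _ => ?_
  rw [← idealVal_image_gen_mul hM, ← Set.image_inter_preimage]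
  simp only [Set.preimage_iInter]

/-- The right ideal of multiples of `x`, empty for `x = ∞`. -/
def topMultiples : WithTop (ArtinMonoid M) → Set (ArtinMonoid M) := WithTop.recTopCoe ∅ multiples

@[simp] theorem topMultiples_coe (x : ArtinMonoid M) :
    topMultiples (x : WithTop (ArtinMonoid M)) = multiples x := rfl

@[simp] theorem topMultiples_top :
    topMultiples (⊤ : WithTop (ArtinMonoid M)) = ∅ := rfl

include hM in
theorem exists_preimage_topMultiples (x : WithTop (ArtinMonoid M)) :
    ∃ y : WithTop (ArtinMonoid M), topLen y ≤ topLen x ∧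
      (gen M s * ·) ⁻¹' topMultiples x = topMultiples y := by
  induction x using WithTop.recTopCoe with
  | top => exact ⟨⊤, le_rfl, rfl⟩
  | coe x =>
    rcases dvd_gen_mul_cases hM s x with h | ⟨z, hz, h⟩
    · exact ⟨⊤, by simp, Set.eq_empty_of_forall_notMem h⟩
    · exact ⟨z, hz, Set.ext h⟩

include hM in
/-- Nonnegativity of alternating sums for all families of elements follows from nonnegativity for
families of generators, if the functions `φ a` can be translated by generators. -/
theorem altSum_nonneg {α : Type*} (φ : α → ArtinMonoid M → ℝ)
    (hgen : ∀ (J : Finset (ArtinMonoid M)), (J : Set (ArtinMonoid M)) ⊆ artinGenerators M →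
      ∀ a, 0 ≤ altSum (φ a) Set.univ J multiples)
    {ι : Type*} [DecidableEq ι]
    (htrans : ∀ (s : S) (t : Finset ι) (I : ι → Set (ArtinMonoid M)),
      (∀ a, 0 ≤ altSum (φ a) Set.univ t I) →
        ∀ a, 0 ≤ altSum (fun x => φ a (gen M s * x)) Set.univ t I)
    (t : Finset ι) (x : ι → WithTop (ArtinMonoid M)) (a : α) :
    0 ≤ altSum (φ a) Set.univ t fun k => topMultiples (x k) := by
  classical
  -- The `+ 1` makes the measure drop even when a deleted entry has length zero.
  induction hn : ∑ k ∈ t, (topLen (x k) + 1) using Nat.strong_induction_on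
    generalizing t x a with
  | _ n ih =>
  have herase : ∀ k ∈ t, (∀ a, altSum (φ a) (topMultiples (x k)) (t.erase k)
      (fun k => topMultiples (x k)) = 0) →
      0 ≤ altSum (φ a) Set.univ t fun k => topMultiples (x k) := by
    intro k hk h
    have hlt : ∑ l ∈ t.erase k, (topLen (x l) + 1) < n := by
      rw [← hn, ← Finset.add_sum_erase t _ hk]; omega
    rw [← Finset.insert_erase hk, altSum_insert _ _ _ (Finset.notMem_erase k t), Set.univ_inter, h,
      sub_zero]
    exact ih _ hlt _ _ _ rfl
  by_cases htop : ∃ k ∈ t, x k = ⊤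
  · obtain ⟨k, hk, hx⟩ := htop
    exact herase k hk fun a => by rw [hx, topMultiples_top, altSum_set_empty]
  by_cases hone : ∃ k ∈ t, x k = (1 : ArtinMonoid M)
  · obtain ⟨k, hk, hx⟩ := hone
    refine (altSum_eq_zero _ _ hk ?_).ge
    rw [hx, topMultiples_coe, multiples_one]
  by_cases hdup : ∃ k ∈ t, ∃ l ∈ t, k ≠ l ∧ x k = x l
  · obtain ⟨k, hk, l, hl, hkl, hx⟩ := hdup
    exact herase k hk fun a => altSum_eq_zero _ _ (Finset.mem_erase.2 ⟨hkl.symm, hl⟩) (by rw [hx])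
  by_cases hdec : ∃ k ∈ t, ∃ s q, q ≠ 1 ∧ x k = (gen M s * q : ArtinMonoid M)
  · obtain ⟨k, hk, s, q, hq, hx⟩ := hdec
    have hq' : len q ≠ 0 := fun h => hq (len_eq_zero.1 h)
    set r := t.erase k with hr
    have hkr : k ∉ r := Finset.notMem_erase k t
    have ht : insert k r = t := Finset.insert_erase hk
    choose y hy hy' using fun j => exists_preimage_topMultiples hM s (x j)
    have hlen : n = len q + 1 + 1 + ∑ l ∈ r, (topLen (x l) + 1) := by
      rw [← hn, ← ht, Finset.sum_insert hkr, hx, topLen_coe, len_mul, len_gen]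
      ring
    have hsum : ∀ (z : ι → WithTop (ArtinMonoid M)) (w : WithTop (ArtinMonoid M)),
        ∑ l ∈ insert k r, (topLen (Function.update z k w l) + 1) =
          topLen w + 1 + ∑ l ∈ r, (topLen (z l) + 1) := by
      intro z w
      rw [Finset.sum_insert hkr, Function.update_self]
      congr 1
      refine Finset.sum_congr rfl fun l hl => ?_
      rw [Function.update_of_ne (ne_of_mem_of_not_mem hl hkr)]
    have halt : ∀ (ψ : ArtinMonoid M → ℝ) (z : ι → WithTop (ArtinMonoid M))
        (w : WithTop (ArtinMonoid M)),
        altSum ψ Set.univ (insert k r) (fun l => topMultiples (Function.update z k w l)) =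
          altSum ψ Set.univ r (fun l => topMultiples (z l)) -
            altSum ψ (topMultiples w) r (fun l => topMultiples (z l)) := by
      intro ψ z w
      rw [altSum_insert _ _ _ hkr, Function.update_self, Set.univ_inter]
      congr 1 <;>
      exact altSum_congr _ _ fun l hl => by
        rw [Function.update_of_ne (ne_of_mem_of_not_mem hl hkr)]
    have h1 : 0 ≤ altSum (φ a) Set.univ (insert k r)
        (fun l => topMultiples (Function.update x k (gen M s : WithTop (ArtinMonoid M)) l)) := by
      refine ih _ ?_ _ _ _ rfl
      rw [hsum, topLen_coe, len_gen]
      omega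
    -- All parameters are needed: translation by `s` replaces `a` by other ones.
    have h2 : ∀ a, 0 ≤ altSum (φ a) Set.univ (insert k r)
        (fun l => topMultiples (Function.update y k (q : WithTop (ArtinMonoid M)) l)) := by
      intro a
      refine ih _ ?_ _ _ _ rfl
      have : ∑ l ∈ r, (topLen (y l) + 1) ≤ ∑ l ∈ r, (topLen (x l) + 1) :=
        Finset.sum_le_sum fun l _ => Nat.add_le_add_right (hy l) 1
      rw [hsum, topLen_coe]
      omega
    have h3 := htrans s _ _ h2 a
    -- Writing `Z(I)` for the sum over `r` inside `I`, these become `Z(P) - Z(sP) ≥ 0` and `Z(sP) -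
    -- Z(sqP) ≥ 0`; their sum telescopes to the goal.
    rw [halt] at h1 h3
    simp only [← hy'] at h3
    rw [← altSum_image_gen_mul hM, ← altSum_image_gen_mul hM, ← multiples_one, topMultiples_coe,
      image_gen_mul_multiples, image_gen_mul_multiples, mul_one] at h3
    rw [topMultiples_coe] at h1
    rw [← ht, altSum_insert _ _ _ hkr, Set.univ_inter, hx, topMultiples_coe]
    linarith
  · push Not at htop hone hdup hdec
    have hall : ∀ k ∈ t, ∃ s, x k = (gen M s : WithTop (ArtinMonoid M)) := by
      intro k hk
      obtain ⟨z, hz⟩ := WithTop.ne_top_iff_exists.1 (htop k hk)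
      obtain rfl | ⟨s, w, rfl⟩ := eq_one_or_eq_gen_mul z
      · exact absurd hz.symm (hone k hk)
      · by_cases hw : w = 1
        · exact ⟨s, by rw [← hz, hw, mul_one]⟩
        · exact absurd hz.symm (hdec k hk s w hw)
    -- The default `1` never occurs on `t`, where all entries are generators.
    let f : ι → ArtinMonoid M := fun k => (x k).untopD 1
    have hf : ∀ k ∈ t, (f k : WithTop (ArtinMonoid M)) = x k := by
      intro k hk
      obtain ⟨s, hs⟩ := hall k hk
      simp only [f, hs, WithTop.untopD_coe]
    have hinj : Set.InjOn f t := by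
      intro k hk l hl hkl
      by_contra hne
      exact hdup k hk l hl hne (by rw [← hf k hk, ← hf l hl, hkl])
    have h := hgen (t.image f) (by
      intro z hz
      obtain ⟨k, hk, rfl⟩ := Finset.mem_image.1 (Finset.mem_coe.1 hz)
      obtain ⟨s, hs⟩ := hall k hk
      exact ⟨s, by simp only [f, hs, WithTop.untopD_coe]⟩) a
    rw [altSum_image _ _ _ _ _ hinj] at h
    rwa [altSum_congr (I' := fun k => multiples (f k)) _ _ fun k hk => by
      rw [← hf k hk, topMultiples_coe]]

end ArtinMonoid

/-! ### Reduction of positivity to generators -/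

theorem isRightLCM_iff {P : Type*} [Monoid P] {K : Finset P} {r : P} :
    IsRightLCM (K : Set P) r ↔ ⋂ k ∈ K, multiples k = multiples r := by
  constructor
  · rintro ⟨h1, h2⟩
    ext y
    simp only [Set.mem_iInter]
    exact ⟨fun h => h2 y h, fun h k hk => (h1 k hk).trans h⟩
  · intro h
    have h' : ∀ y, (∀ k ∈ K, k ∣ y) ↔ r ∣ y := fun y => by
      have := Set.ext_iff.1 h y
      simp only [Set.mem_iInter] at this
      exact this
    exact ⟨(h' r).2 dvd_rfl, fun y hy => (h' y).1 hy⟩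

namespace ArtinMonoid

open Filter Topology

variable {S : Type*} {M : CoxeterMatrix S} {A : Type*} [NonUnitalCStarAlgebra A] [PartialOrder A]
  {X : ArtinMonoid M → Type*}
  [∀ p, NormedAddCommGroup (X p)] [∀ p, NormedSpace ℂ (X p)] [∀ p, CompleteSpace (X p)]
  [∀ p, CStarCorrespondence A (X p)]
  {N : ArtinMonoid M →* ℝ} {β : ℝ} {τ : A →L[ℂ] ℂ}

variable (X N β τ) in
/-- The weighted induced trace `N(x)^{-β} Tr_τ^x(a)` as a real number. -/
noncomputable def weightedTrace (a : A) (x : ArtinMonoid M) : ℝ :=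
  N x ^ (-β) * (inducedTrace (X x) τ a).toReal

theorem positivityTerm_eq {a : A} (hfin : ∀ x, inducedTrace (X x) τ a ≠ ⊤)
    (K : Finset (ArtinMonoid M)) :
    positivityTerm X N β τ a K = (((-1) ^ K.card *
      idealVal (weightedTrace X N β τ a) (Set.univ ∩ ⋂ k ∈ K, multiples k) : ℝ) : EReal) := by
  rw [Set.univ_inter]
  by_cases h : ∃ r, IsRightLCM (K : Set (ArtinMonoid M)) r
  · have hr : rightLCM (K : Set (ArtinMonoid M)) = (h.choose : WithTop (ArtinMonoid M)) := by
      rw [rightLCM, dif_pos h]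
    rw [isRightLCM_iff.1 h.choose_spec, idealVal_multiples, positivityTerm, hr]
    simp only
    rw [weightedTrace, ← mul_assoc, EReal.coe_mul _ (ENNReal.toReal _),
      EReal.coe_ennreal_toReal (hfin _)]
  · have hr : rightLCM (K : Set (ArtinMonoid M)) = ⊤ := by
      rw [rightLCM, dif_neg h]
    have h' : ¬ ∃ r, ⋂ k ∈ K, multiples k = multiples r := by
      simpa only [isRightLCM_iff] using h
    rw [positivityTerm, hr, idealVal, dif_neg h']
    simp

/-- `τ(a)` is the term of `K = ∅`, whose ideal is `P = eP`. Finiteness of the traces lets the sum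
leave `EReal`. -/
theorem positivity_iff_altSum_nonneg [StarOrderedRing A] (Y : ProductSystem A X)
    (hτ : IsTracialState τ) {a : A} (ha : 0 ≤ a)
    (hfin : ∀ x, inducedTrace (X x) τ a ≠ ⊤) (J : Finset (ArtinMonoid M)) :
    (0 ≤ (((τ a).re : ℝ) : EReal) +
      ∑ K ∈ J.powerset.filter (fun K => K.Nonempty), positivityTerm X N β τ a K) ↔
    0 ≤ altSum (weightedTrace X N β τ a) Set.univ J multiples := by
  classical
  have h1 : idealVal (weightedTrace X N β τ a) Set.univ = (τ a).re := by
    rw [← multiples_one, idealVal_multiples, weightedTrace, map_one, Real.one_rpow, one_mul,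
      Y.inducedTrace_one hτ (IsSelfAdjoint.of_nonneg (CFC.sqrt_nonneg a)).star_eq
        (CFC.sqrt_mul_sqrt_self a ha), ENNReal.toReal_ofReal (hτ.nonneg a ha).1]
  have h2 : J.powerset.filter (fun K => K.Nonempty) = J.powerset.erase ∅ := by
    ext K
    simp [Finset.nonempty_iff_ne_empty, and_comm]
  rw [altSum, ← Finset.add_sum_erase _ _ (Finset.empty_mem_powerset J), h2]
  simp only [positivityTerm_eq hfin]
  rw [← EReal.coe_nonneg]
  have h3 : ∀ s : Finset (Finset (ArtinMonoid M)), ∀ f : Finset (ArtinMonoid M) → ℝ,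
      ((∑ K ∈ s, f K : ℝ) : EReal) = ∑ K ∈ s, (f K : EReal) := fun s f =>
    map_sum (⟨⟨Real.toEReal, rfl⟩, EReal.coe_add⟩ : ℝ →+ EReal) f s
  rw [EReal.coe_add, h3]
  simp [h1]

theorem inducedTrace_gen_le (hN : ∀ p, 0 < N p)
    (h : PositivityOn X N β τ (artinGenerators M)) (s : S) {a : A} (ha : 0 ≤ a) :
    inducedTrace (X (gen M s)) τ a ≤
      ENNReal.ofReal ((N (gen M s) ^ (-β))⁻¹) * ENNReal.ofReal (τ a).re := by
  classical
  have hc : 0 < N (gen M s) ^ (-β) := Real.rpow_pos_of_pos (hN _) _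
  have h1 := h {gen M s} (by rw [Finset.coe_singleton, Set.singleton_subset_iff]; exact ⟨s, rfl⟩)
    a ha
  have h2 : ({gen M s} : Finset (ArtinMonoid M)).powerset.filter (fun K => K.Nonempty) =
      {{gen M s}} := by
    ext K
    simp only [Finset.mem_filter, Finset.mem_powerset, Finset.mem_singleton,
      Finset.subset_singleton_iff]
    constructor
    · rintro ⟨rfl | rfl, h⟩
      · simp at h
      · rfl
    · rintro rfl
      simp
  have h3 : ∃ r, IsRightLCM (({gen M s} : Finset (ArtinMonoid M)) : Set (ArtinMonoid M)) r :=
    ⟨gen M s, isRightLCM_iff.2 (by simp)⟩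
  have h4 : rightLCM (({gen M s} : Finset (ArtinMonoid M)) : Set (ArtinMonoid M)) =
      (gen M s : WithTop (ArtinMonoid M)) := by
    rw [rightLCM, dif_pos h3]
    have := isRightLCM_iff.1 h3.choose_spec
    have h5 : h3.choose = gen M s := multiples_injective (this.symm.trans (by simp))
    rw [h5]
  rw [h2, Finset.sum_singleton, positivityTerm, h4] at h1
  simp only [Finset.card_singleton, pow_one, neg_mul, one_mul] at h1
  generalize inducedTrace (X (gen M s)) τ a = t at h1 ⊢
  induction t using ENNReal.recTopCoe with
  -- An infinite trace has a negative coefficient, making the sum `-∞`.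
  | top =>
    rw [EReal.coe_ennreal_top, EReal.coe_mul_top_of_neg (by linarith), EReal.add_bot] at h1
    simp at h1
  | coe t =>
    have h5 : (0 : ℝ) ≤ (τ a).re + -N (gen M s) ^ (-β) * t := by
      rw [show (((t : ℝ≥0∞)) : EReal) = ((t : ℝ) : EReal) from rfl] at h1
      exact_mod_cast h1
    rw [← ENNReal.ofReal_mul (by positivity), ← ENNReal.ofReal_coe_nnreal]
    refine ENNReal.ofReal_le_ofReal ?_
    rw [le_inv_mul_iff₀ hc]
    linarith

variable [StarOrderedRing A]

/-- By stages, `Tr^{sx}(a)` is a limit of sums bounded by `C ∑ τ(⟨ξ, aξ⟩) ≤ C Tr^s(a)`. The constant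
must be uniform in `a`, since the induction applies it to every `⟨ξ, aξ⟩`. -/
theorem exists_inducedTrace_le (Y : ProductSystem A X) (hN : ∀ p, 0 < N p)
    (hτ : IsTracialState τ) (h : PositivityOn X N β τ (artinGenerators M)) (x : ArtinMonoid M) :
    ∃ C : ℝ≥0∞, C ≠ ⊤ ∧ ∀ a : A, 0 ≤ a →
      inducedTrace (X x) τ a ≤ C * ENNReal.ofReal (τ a).re := by
  classical
  induction x using induction_gen with
  | one =>
    refine ⟨1, ENNReal.one_ne_top, fun a ha => ?_⟩
    rw [one_mul, Y.inducedTrace_one hτ (IsSelfAdjoint.of_nonneg (CFC.sqrt_nonneg a)).star_eq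
        (CFC.sqrt_mul_sqrt_self a ha)]
  | gen_mul s x ih =>
    obtain ⟨C, hC, hC'⟩ := ih
    refine ⟨C * ENNReal.ofReal ((N (gen M s) ^ (-β))⁻¹), ENNReal.mul_ne_top hC ENNReal.ofReal_ne_top,
      fun a ha => ?_⟩
    obtain ⟨u, hu, hu'⟩ := exists_approx_unit A (X (gen M s))
    have hb := (IsSelfAdjoint.of_nonneg (CFC.sqrt_nonneg a)).star_eq
    have hab := CFC.sqrt_mul_sqrt_self a ha
    have hpos : ∀ ξ : X (gen M s), 0 ≤ (inn ξ (lact a ξ) : A) := fun ξ => by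
      rw [← hab, CStarCorrespondence.lact_mul, inn_lact_right, hb]
      exact inn_self_nonneg _
    refine le_of_tendsto' (Y.tendsto_sum_inducedTrace hτ (gen_ne_one s) hu hu' x hb hab) fun i => ?_
    calc ∑ ξ ∈ u i, inducedTrace (X x) τ (inn ξ (lact a ξ))
        ≤ ∑ ξ ∈ u i, C * ENNReal.ofReal (τ (inn ξ (lact a ξ))).re :=
          Finset.sum_le_sum fun ξ _ => hC' _ (hpos ξ)
      _ = C * ENNReal.ofReal (∑ ξ ∈ u i, (τ (inn ξ (lact a ξ))).re) := by
          rw [← Finset.mul_sum, ENNReal.ofReal_sum_of_nonneg fun ξ _ => (hτ.nonneg _ (hpos ξ)).1]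
      _ ≤ C * inducedTrace (X (gen M s)) τ a := by
          gcongr
          exact (hu i).le_inducedTrace τ a
      _ ≤ _ := by
          rw [mul_assoc]
          gcongr
          exact inducedTrace_gen_le hN h s ha

/-- The translated function is a pointwise limit of `N(s)^{-β}` times finite sums of the functions
attached to `⟨ξ, aξ⟩ ≥ 0`, and `altSum` is linear and continuous in the function. -/
theorem altSum_weightedTrace_gen_mul_nonneg (Y : ProductSystem A X) (hN : ∀ p, 0 < N p)
    (hτ : IsTracialState τ) (hfin : ∀ a : A, 0 ≤ a → ∀ x, inducedTrace (X x) τ a ≠ ⊤)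
    {ι : Type*} (s : S) (t : Finset ι) (I : ι → Set (ArtinMonoid M))
    (h : ∀ a : A, 0 ≤ a → 0 ≤ altSum (weightedTrace X N β τ a) Set.univ t I)
    {a : A} (ha : 0 ≤ a) :
    0 ≤ altSum (fun x => weightedTrace X N β τ a (gen M s * x)) Set.univ t I := by
  classical
  obtain ⟨u, hu, hu'⟩ := exists_approx_unit A (X (gen M s))
  have hb := (IsSelfAdjoint.of_nonneg (CFC.sqrt_nonneg a)).star_eq
  have hab := CFC.sqrt_mul_sqrt_self a ha
  have hpos : ∀ ξ : X (gen M s), 0 ≤ (inn ξ (lact a ξ) : A) := fun ξ => by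
    rw [← hab, CStarCorrespondence.lact_mul, inn_lact_right, hb]
    exact inn_self_nonneg _
  have hlim : ∀ x, Tendsto (fun i => N (gen M s) ^ (-β) *
      ∑ ξ ∈ u i, weightedTrace X N β τ (inn ξ (lact a ξ)) x) atTop
      (𝓝 (weightedTrace X N β τ a (gen M s * x))) := by
    intro x
    have h1 := (ENNReal.tendsto_toReal (hfin a ha (gen M s * x))).comp
      (Y.tendsto_sum_inducedTrace hτ (gen_ne_one s) hu hu' x hb hab)
    have h2 := h1.const_mul (N (gen M s * x) ^ (-β))
    rw [weightedTrace]
    refine h2.congr fun i => ?_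
    simp only [Function.comp_apply, weightedTrace]
    rw [ENNReal.toReal_sum fun ξ _ => hfin _ (hpos ξ) x, map_mul,
      Real.mul_rpow (hN _).le (hN _).le, Finset.mul_sum, Finset.mul_sum]
    exact Finset.sum_congr rfl fun ξ _ => by ring
  refine ge_of_tendsto' (tendsto_altSum Set.univ I hlim t) fun i => ?_
  rw [altSum_mul_left, altSum_sum]
  exact mul_nonneg (Real.rpow_nonneg (hN _).le _) (Finset.sum_nonneg fun ξ _ => h _ (hpos ξ))

theorem positivityOn_iff (hM : IsRightAngled M) (Y : ProductSystem A X) (hN : ∀ p, 0 < N p)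
    (hτ : IsTracialState τ) :
    PositivityOn X N β τ {p | p ≠ 1} ↔ PositivityOn X N β τ (artinGenerators M) := by
  classical
  constructor
  · intro h J hJ
    refine h J (hJ.trans ?_)
    rintro _ ⟨s, rfl⟩
    exact gen_ne_one s
  · intro h J _ a ha
    have hfin : ∀ a : A, 0 ≤ a → ∀ x, inducedTrace (X x) τ a ≠ ⊤ := fun a ha x => by
      obtain ⟨C, hC, hC'⟩ := exists_inducedTrace_le Y hN hτ h x
      exact ((hC' a ha).trans_lt (ENNReal.mul_lt_top hC.lt_top ENNReal.ofReal_lt_top)).ne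
    rw [positivity_iff_altSum_nonneg Y hτ ha (hfin a ha)]
    exact altSum_nonneg hM (fun a : {a : A // 0 ≤ a} => weightedTrace X N β τ a.1)
      (fun J hJ a => (positivity_iff_altSum_nonneg Y hτ a.2 (hfin a.1 a.2) J).1 (h J hJ a.1 a.2))
      (fun s t I hI a => altSum_weightedTrace_gen_mul_nonneg Y hN hτ hfin s t I
        (fun a ha => hI ⟨a, ha⟩) a.2) J (fun k => (k : WithTop (ArtinMonoid M))) ⟨a, ha⟩

end ArtinMonoid

theorem mainTheorem7 {S : Type*} (M : CoxeterMatrix S) (hM : IsRightAngled M) :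
    (∀ (n : ℕ) (μ : Fin n → WithTop (ArtinMonoid M)),
      Nonempty (ListTree μ) ∧ ∀ 𝒯 : ListTree μ, 𝒯.nodes.Finite) ∧
    (∀ {A : Type*} [NonUnitalCStarAlgebra A] [PartialOrder A] [StarOrderedRing A]
      (X : ArtinMonoid M → Type*)
      [∀ p, NormedAddCommGroup (X p)] [∀ p, NormedSpace ℂ (X p)] [∀ p, CompleteSpace (X p)]
      [∀ p, CStarCorrespondence A (X p)] (_ : ProductSystem A X)
      (N : ArtinMonoid M →* ℝ) (_ : ∀ p, 0 < N p) (β : ℝ)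
      (τ : A →L[ℂ] ℂ) (_ : IsTracialState τ),
      PositivityOn X N β τ {p | p ≠ 1} ↔ PositivityOn X N β τ (artinGenerators M)) := by

  refine ⟨fun n μ => ⟨ArtinMonoid.nonempty_listTree μ,
    fun 𝒯 => ArtinMonoid.ListTree.finite_nodes hM 𝒯⟩, ?_⟩
  intro A _ _ _ X _ _ _ _ Y N hN β τ hτ
  exact ArtinMonoid.positivityOn_iff hM Y hN hτ
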